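/- Let $\mathbb A$ be a finite alphabet, $S:\mathbb A\times\mathbb A\to[0,\infty)$ a pairwise scoring function and $\delta\in\mathbb R$. For $z=((x_1,y_1),\dots,(x_n,y_n))\in(\mathbb A\times\mathbb A)^n$ let $$L(z)=\max_{k,\rho,\tau}\Big\{\sum_{i=1}^k S(x_{\rho_i},y_{\tau_i})+\delta(n-k)\Big\},$$ the maximum being over all $0\le k\le n$ and all $1\le\rho_1<\dots<\rho_k\le n$, $1\le\tau_1<\dots<\tau_k\le n$. Put $$\Delta=\max_{u,v,w\in\mathbb A}\max\{|S(u,v)-S(u,w)|,\ |S(v,u)-S(w,u)|\}$$ (so $\Delta=\max_{u,v,w}|S(u,v)-S(u,w)|$ when $S$ is symmetric). Let $Z_1,Z_2,\dots$, $Z_i=(X_i,Y_i)$, be a stationary, irreducible and aperiodic Markov chain with state space $\mathbb A\times\mathbb A$, transition matrix $\mathbb P=(p_{\mathbf A\mathbf B})$ and stationary distribution $\pi$ (the law of $Z_1$). Let $t_{mix}$ be the least integer $t\ge0$ such that $\max_{\mathbf A}\|\mathbb P^t(\mathbf A,\cdot)-\pi\|_{TV}\le\frac14$, where $\|p-q\|_{TV}=\frac12\sum_{\mathbf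 B}|p(\mathbf B)-q(\mathbf B)|$. Put $L_n=L(Z_1,\dots,Z_n)$ and $F=32\,\Delta^2\,t_{mix}$. 1. (Tail bound.) For all $n\ge1$ and $s>0$, $$P\big(|L_n-EL_n|\ge s\big)\le 2\exp\Big(-\frac{s^2}{nF}\Big),$$ where the right-hand side is read as $0$ if $F=0$. 2. (Moment bound.) For all $r>0$ and $n\ge1$, $$E|L_n-EL_n|^r\le C(r)\,n^{r/2},\qquad C(r)=F^{r/2}\Big[(\ln2)^{r/2}+r\int_{\ln2}^\infty e^{-u}u^{r/2-1}\,du\Big].$$ 3. (Order of the moments.) Let $\mathbf A,\mathbf B,\mathbf D\in\mathbb A\times\mathbb A$ satisfy $P(Z_1=\mathbf A,Z_3=\mathbf B)>0$ and $p_{\mathbf A\mathbf D}\,p_{\mathbf D\mathbf B}>0$. For $z\in(\mathbb A\times\mathbb A)^n$ let $\mathcal R(z)$ be the random word obtained by choosing, uniformly at random (independently of $Z$), one of those triplets $(z_{3i-2},z_{3i-1},z_{3i})$, $1\le i\le\lfloor n/3\rfloor$, with $z_{3i-2}=\mathbf A$, $z_{3i}=\mathbf B$, $z_{3i-1}\ne\mathbf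 D$, and replacing its middle letter by $\mathbf D$ (and $\mathcal R(z)=z$ if there is no such triplet). Suppose that there are $\epsilon_o>0$ and a sequence $\Delta_n\to0$ such that, for all $n$, with $Z=(Z_1,\dots,Z_n)$, $$P\big(E[L(\mathcal R(Z))-L(Z)\mid Z]\ge\epsilon_o\big)\ge1-\Delta_n .$$ Then for every $r\ge1$, $E|L_n-EL_n|^r\asymp n^{r/2}$ as $n\to\infty$; that is, there are constants $0<c\le C<\infty$ with $c\,n^{r/2}\le E|L_n-EL_n|^r\le C\,n^{r/2}$ for all sufficiently large $n$. -/

import Mathlib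

open MeasureTheory Filter Topology

namespace PMC

/-! ### Optimal alignment scores -/

section Score

variable {𝔸 : Type*}

/-- An alignment of two words of length `n`: a number `k` of aligned letters and two strictly
increasing sequences `ρ₁ < ⋯ < ρₖ` and `τ₁ < ⋯ < τₖ` of positions (the empty alignment `k = 0`
is allowed; `k ≤ n` is automatic). -/
structure Alignment (n : ℕ) where
  k : ℕ
  ρ : Fin k ↪o Fin n
  τ : Fin k ↪o Fin n

/-- The score `∑ S (X_{ρᵢ}, Y_{τᵢ}) + δ (n - k)` of an alignment of the word pair
`z = ((X₁, Y₁), …, (Xₙ, Yₙ))`. -/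
def alignmentScore (S : 𝔸 → 𝔸 → ℝ) (δ : ℝ) {n : ℕ} (z : Fin n → 𝔸 × 𝔸) (a : Alignment n) : ℝ :=
  ∑ i : Fin a.k, S (z (a.ρ i)).1 (z (a.τ i)).2 + δ * ((n : ℝ) - (a.k : ℝ))

/-- The optimal score `L(z)`: the maximum over all (finitely many) alignments. -/
noncomputable def score (S : 𝔸 → 𝔸 → ℝ) (δ : ℝ) {n : ℕ} (z : Fin n → 𝔸 × 𝔸) : ℝ :=
  ⨆ a : Alignment n, alignmentScore S δ z a

/-- The maximal change `Δ` of the pairwise score when one of its two letters is changed, in either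
slot. For symmetric `S` this is `max_{u,v,w} |S(u,v) - S(u,w)|`. -/
noncomputable def maxChange (S : 𝔸 → 𝔸 → ℝ) : ℝ :=
  ⨆ p : 𝔸 × 𝔸 × 𝔸,
    max |S p.1 p.2.1 - S p.1 p.2.2| |S p.2.1 p.1 - S p.2.2 p.1|

end Score

/-! ### Stationary aperiodic Markov chains and mixing times -/

section Chain

variable {E : Type*} [Fintype E] [DecidableEq E]

/-- `Z` is a stationary Markov chain with transition matrix `P` on the finite state space `E`.
The Markov property `P(Z_{n+1} = b | Z₀, …, Zₙ) = P (Zₙ, b)` is written multiplied out. -/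
structure IsStationaryMarkovChain [MeasurableSpace E] {Ω : Type*} [MeasurableSpace Ω]
    (μ : Measure Ω) (P : Matrix E E ℝ) (Z : ℕ → Ω → E) : Prop where
  measurable : ∀ n, Measurable (Z n)
  stochastic : P ∈ Matrix.rowStochastic ℝ E
  markov : ∀ (n : ℕ) (x : ℕ → E) (b : E),
    μ.real {ω | (∀ i ≤ n, Z i ω = x i) ∧ Z (n + 1) ω = b} =
      μ.real {ω | ∀ i ≤ n, Z i ω = x i} * P (x n) b
  stationary : ∀ (n : ℕ) (a : E), μ.real {ω | Z n ω = a} = μ.real {ω | Z 0 ω = a}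

/-- Aperiodicity: for every state `a`, the set of possible return times
`{k ≥ 1 : Pᵏ(a, a) > 0}` has greatest common divisor `1`. -/
def IsAperiodic (P : Matrix E E ℝ) : Prop :=
  ∀ (a : E) (d : ℕ), (∀ k : ℕ, 0 < k → 0 < (P ^ k) a a → d ∣ k) → d = 1

/-- Total variation distance of two probability vectors. -/
noncomputable def tvDist (p q : E → ℝ) : ℝ := (1 / 2) * ∑ b, |p b - q b|

/-- The mixing time `t(ε)`: the least `t` with `max_a ‖Pᵗ(a, ·) - π‖_TV ≤ ε`. -/
noncomputable def mixingTime (P : Matrix E E ℝ) (π : E → ℝ) (ε : ℝ) : ℕ :=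
  sInf {t : ℕ | ∀ a : E, tvDist (fun b => (P ^ t) a b) π ≤ ε}

end Chain

/-! ### The random transformation -/

section Transformation

variable {E : Type*} [DecidableEq E]

/-- Position `j ∈ {0, 1, 2}` of the `i`-th of the `⌊n/3⌋` consecutive disjoint triplets. -/
def tripletPos {n : ℕ} (i : Fin (n / 3)) (j : Fin 3) : Fin n :=
  ⟨3 * i.val + j.val, by have := i.isLt; have := j.isLt; omega⟩

/-- The triplets of `z` of the form `(A, ·, B)` whose middle letter is not `D`. -/
def eligible (A B D : E) {n : ℕ} (z : Fin n → E) : Finset (Fin (n / 3)) :=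
  Finset.univ.filter fun i =>
    z (tripletPos i 0) = A ∧ z (tripletPos i 2) = B ∧ z (tripletPos i 1) ≠ D

/-- The law of the random transformation `R(z)`: choose uniformly one of the triplets `(A, ·, B)`
whose middle letter is not `D` and change its middle letter into `D`; if there is no such triplet,
leave `z` unchanged. -/
noncomputable def randomTransform (A B D : E) {n : ℕ} (z : Fin n → E) : PMF (Fin n → E) :=
  if h : (eligible A B D z).Nonempty then
    (PMF.uniformOfFinset (eligible A B D z) h).map fun i => Function.update z (tripletPos i 1) D
  else PMF.pure z

/-- The conditional expectation `E[f(R(Z)) - f(Z) | Z = z]`. -/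
noncomputable def expectedGain [Fintype E] (A B D : E) {n : ℕ} (f : (Fin n → E) → ℝ)
    (z : Fin n → E) : ℝ :=
  ∑ z' : Fin n → E, (randomTransform A B D z z').toReal * (f z' - f z)

end Transformation

/-! ### Pairwise Markov chains -/

section Model

variable {𝔸 : Type*} {Ω : Type*} [MeasurableSpace Ω]

/-- The random score `Lₙ = L(Z₁, …, Zₙ)` (the chain is indexed from `0` here). -/
noncomputable def Ln (S : 𝔸 → 𝔸 → ℝ) (δ : ℝ) (Z : ℕ → Ω → 𝔸 × 𝔸) (n : ℕ) (ω : Ω) : ℝ :=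
  score S δ (fun i : Fin n => Z i ω)

/-- The centred absolute score `Wₙ = |Lₙ - E Lₙ|`. -/
noncomputable def Wn (μ : Measure Ω) (S : 𝔸 → 𝔸 → ℝ) (δ : ℝ) (Z : ℕ → Ω → 𝔸 × 𝔸) (n : ℕ)
    (ω : Ω) : ℝ :=
  |Ln S δ Z n ω - ∫ ω', Ln S δ Z n ω' ∂μ|

/-- The constant `F = 32 Δ² t_mix`, where `t_mix = t(1/4)` and the stationary distribution is the
law of `Z₁`. -/
noncomputable def constF [Fintype 𝔸] [DecidableEq 𝔸] (μ : Measure Ω) (S : 𝔸 → 𝔸 → ℝ)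
    (P : Matrix (𝔸 × 𝔸) (𝔸 × 𝔸) ℝ) (Z : ℕ → Ω → 𝔸 × 𝔸) : ℝ :=
  32 * maxChange S ^ 2 * (mixingTime P (fun a => μ.real {ω | Z 0 ω = a}) (1 / 4) : ℝ)

/-- The constant `C(r) = F^{r/2} [(ln 2)^{r/2} + r ∫_{ln 2}^∞ e^{-u} u^{r/2-1} du]`. -/
noncomputable def constC (F r : ℝ) : ℝ :=
  F ^ (r / 2) * (Real.log 2 ^ (r / 2) +
    r * ∫ u in Set.Ioi (Real.log 2), Real.exp (-u) * u ^ (r / 2 - 1))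

/-- The random transformation determined by `A, B, D` increases the conditional expected score by
at least `ε` with probability tending to one:
`P(E[L(R(Z)) - L(Z) | Z] ≥ ε) ≥ 1 - ηₙ` for some `ηₙ → 0`. -/
def IncreasesScore [Fintype 𝔸] [DecidableEq 𝔸] (μ : Measure Ω) (S : 𝔸 → 𝔸 → ℝ) (δ : ℝ)
    (Z : ℕ → Ω → 𝔸 × 𝔸) (A B D : 𝔸 × 𝔸) (ε : ℝ) : Prop :=
  ∃ η : ℕ → ℝ, Tendsto η atTop (𝓝 0) ∧
    ∀ n : ℕ, 1 - η n ≤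
      μ.real {ω | ε ≤ expectedGain A B D (score S δ) (fun i : Fin n => Z i ω)}

end Model

end PMC

/-! Changing one pair `(x_i, y_i)` moves the optimal score by at most `2Δ`, since an alignment uses
each position at most once in either word. So the score is Lipschitz for the Hamming distance with
constant `c = 2Δ`.

Upper bounds. The chain is cut into blocks of `t = t_mix` letters. Replacing the first block changes
the conditional expectation of the score by at most `c t` through the letters of the block and by at
most `2 c t` through the law of the future: by `pathExp_sub_le_sum_tvDist` the latter effect is at
most `c` times the summed total variation distances at later times, and these are halved every `t`
steps. Hoeffding's lemma, applied block by block, gives a sub-Gaussian moment generating function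
(`pathExp_exp_le`). Chernoff's bound then gives the tail, and integrating the tail gives the
moments.

Lower bound. Given all other letters, the letter between `A` and `B` is `D` with probability `1/κ`,
where `κ = (P ^ 2) A B / (P A D * P D B)`. Hence the centred variable `κ 1_D - 1` on triplets framed
by `A` and `B` satisfies an integration by parts formula (`integral_middleScore_mul`): its integral
against `G` is the expected change of `G` when the middle letter is set to `D`. Let `M` be the sum
of these variables over the triplets. The formula identifies the covariance of `M` and the score
with the mean of (number of eligible triplets) × (expected gain), which is of order at least `n`,
and it makes the summands of `M` orthogonal, so `E M²` is at most of order `n`. Cauchy–Schwarz gives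
a variance of order `n`. With the fourth-moment bound this yields a first moment of order `√n`, and
Jensen's inequality covers every `r ≥ 1`. -/

namespace PMC

/-! ### Expectations along a finite Markov path, as finite sums -/

section Path

variable {E : Type*} [Fintype E]

/-- The expectation of `g (Y₁, …, Yₘ)` for the Markov chain with transition matrix `P` whose first
letter `Y₁` has the law `ν`. -/
noncomputable def pathExp (P : Matrix E E ℝ) : ℕ → (E → ℝ) → (List E → ℝ) → ℝ
  | 0, _, g => g []
  | m + 1, ν, g => ∑ y, ν y * pathExp P m (P y) fun l => g (y :: l)

/-- The probability of a word for the Markov chain with transition matrix `P` and initial law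
`ν`. -/
def pathWeight (P : Matrix E E ℝ) : (E → ℝ) → List E → ℝ
  | _, [] => 1
  | ν, y :: l => ν y * pathWeight P (P y) l

/-- The law of the letter that follows the word `l`, where `ν` is the law of the first letter. -/
def nextLaw (P : Matrix E E ℝ) : (E → ℝ) → List E → E → ℝ
  | ν, [] => ν
  | _, y :: l => nextLaw P (P y) l

variable {P : Matrix E E ℝ}

theorem pathExp_zero (ν : E → ℝ) (g : List E → ℝ) : pathExp P 0 ν g = g [] := rfl

theorem pathExp_succ (m : ℕ) (ν : E → ℝ) (g : List E → ℝ) :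
    pathExp P (m + 1) ν g = ∑ y, ν y * pathExp P m (P y) fun l => g (y :: l) := rfl

theorem pathExp_eq_sum (m : ℕ) (ν : E → ℝ) (g : List E → ℝ) :
    pathExp P m ν g =
      ∑ w : Fin m → E, pathWeight P ν (List.ofFn w) * g (List.ofFn w) := by
  induction m generalizing ν g with
  | zero => simp [pathExp, pathWeight]
  | succ m ih =>
    rw [pathExp_succ, ← (Fin.consEquiv fun _ : Fin (m + 1) => E).sum_comp, Fintype.sum_prod_type]
    refine Finset.sum_congr rfl fun y _ => ?_
    rw [ih, Finset.mul_sum]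
    refine Finset.sum_congr rfl fun w _ => ?_
    simp [Fin.consEquiv, pathWeight, mul_assoc]

theorem pathExp_add (m : ℕ) (ν : E → ℝ) (g h : List E → ℝ) :
    pathExp P m ν (fun l => g l + h l) = pathExp P m ν g + pathExp P m ν h := by
  simp [pathExp_eq_sum, mul_add, Finset.sum_add_distrib]

theorem pathExp_const_mul (m : ℕ) (ν : E → ℝ) (a : ℝ) (g : List E → ℝ) :
    pathExp P m ν (fun l => a * g l) = a * pathExp P m ν g := by
  simp only [pathExp_eq_sum, Finset.mul_sum]
  exact Finset.sum_congr rfl fun _ _ => by ring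

theorem pathExp_congr {m : ℕ} {ν : E → ℝ} {g h : List E → ℝ}
    (H : ∀ l, l.length = m → g l = h l) : pathExp P m ν g = pathExp P m ν h := by
  simp only [pathExp_eq_sum]
  exact Finset.sum_congr rfl fun w _ => by rw [H _ (by simp)]

/-- The Markov property: past the word `u`, the chain restarts with the law `nextLaw P ν u`, which
sees only the last letter of `u` (or `ν` if `u` is empty). -/
theorem pathExp_split (a b : ℕ) (ν : E → ℝ) (g : List E → ℝ) :
    pathExp P (a + b) ν g =
      pathExp P a ν fun u => pathExp P b (nextLaw P ν u) fun l => g (u ++ l) := by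
  induction a generalizing ν g with
  | zero => simp [pathExp_zero, nextLaw]
  | succ a ih =>
    rw [Nat.add_right_comm, pathExp_succ, pathExp_succ]
    simp only [ih, nextLaw, List.cons_append]

section Stochastic

variable [DecidableEq E] (hP : P ∈ Matrix.rowStochastic ℝ E)

include hP

theorem row_mem_stdSimplex (y : E) : P y ∈ stdSimplex ℝ E :=
  ⟨fun _ => Matrix.nonneg_of_mem_rowStochastic hP, Matrix.sum_row_of_mem_rowStochastic hP y⟩

theorem nextLaw_mem_stdSimplex {ν : E → ℝ} (hν : ν ∈ stdSimplex ℝ E) (l : List E) :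
    nextLaw P ν l ∈ stdSimplex ℝ E := by
  induction l generalizing ν with
  | nil => exact hν
  | cons y l ih => exact ih (row_mem_stdSimplex hP y)

theorem pathWeight_nonneg {ν : E → ℝ} (hν : ν ∈ stdSimplex ℝ E) (l : List E) :
    0 ≤ pathWeight P ν l := by
  induction l generalizing ν with
  | nil => simp [pathWeight]
  | cons y l ih => exact mul_nonneg (hν.1 y) (ih (row_mem_stdSimplex hP y))

theorem pathExp_mono {m : ℕ} {ν : E → ℝ} (hν : ν ∈ stdSimplex ℝ E) {g h : List E → ℝ}
    (H : ∀ l, l.length = m → g l ≤ h l) : pathExp P m ν g ≤ pathExp P m ν h := by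
  simp only [pathExp_eq_sum]
  exact Finset.sum_le_sum fun w _ =>
    mul_le_mul_of_nonneg_left (H _ (by simp)) (pathWeight_nonneg hP hν _)

theorem pathExp_const (m : ℕ) {ν : E → ℝ} (hν : ν ∈ stdSimplex ℝ E) (a : ℝ) :
    pathExp P m ν (fun _ => a) = a := by
  induction m generalizing ν with
  | zero => rfl
  | succ m ih =>
    simp only [pathExp_succ, ih (row_mem_stdSimplex hP _)]
    rw [← Finset.sum_mul, hν.2, one_mul]

theorem vecMul_mem_stdSimplex {ν : E → ℝ} (hν : ν ∈ stdSimplex ℝ E) :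
    Matrix.vecMul ν P ∈ stdSimplex ℝ E := by
  refine ⟨fun x => Finset.sum_nonneg fun y _ => mul_nonneg (hν.1 y)
    (Matrix.nonneg_of_mem_rowStochastic hP), ?_⟩
  simp only [Matrix.vecMul, dotProduct]
  rw [Finset.sum_comm]
  simp only [← Finset.mul_sum, Matrix.sum_row_of_mem_rowStochastic hP, mul_one]
  exact hν.2

-- If `g` ignores the first letter, dropping that letter only advances the initial law by one step.
omit hP [DecidableEq E] in
theorem sum_mul_pathExp {ν : E → ℝ} (hν : ∑ y, ν y = 1) (m : ℕ) (g : List E → ℝ) :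
    ∑ y, ν y * pathExp P m (P y) g = pathExp P m (Matrix.vecMul ν P) g := by
  cases m with
  | zero => simp only [pathExp_zero]; rw [← Finset.sum_mul, hν, one_mul]
  | succ m =>
    simp only [pathExp_succ, Matrix.vecMul, dotProduct, Finset.mul_sum, Finset.sum_mul]
    rw [Finset.sum_comm]
    simp only [mul_assoc]

end Stochastic

/-! ### Hoeffding's lemma -/

theorem hoeffding_finite {ι : Type*} [Fintype ι] {p : ι → ℝ} (hp : p ∈ stdSimplex ℝ ι)
    {f : ι → ℝ} {d : ℝ} (hf : ∀ i j, f i - f j ≤ d) (s : ℝ) :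
    ∑ i, p i * Real.exp (s * f i) ≤
      Real.exp (s * ∑ i, p i * f i + s ^ 2 * (d ^ 2 / 8)) := by
  classical
  let _ : MeasurableSpace ι := ⊤
  have hne : Nonempty ι := by
    by_contra h
    rw [not_nonempty_iff] at h
    simpa using hp.2
  obtain ⟨i₀, hi₀⟩ := Finite.exists_min f
  have hd : 0 ≤ d := by simpa using hf i₀ i₀
  -- The weights are turned into a discrete probability measure so that the measure-theoretic
  -- Hoeffding lemma applies; `f` takes values in `[f i₀, f i₀ + d]` with `i₀` a minimiser.
  let μ : Measure ι := ∑ i, ENNReal.ofReal (p i) • Measure.dirac i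
  have hint (g : ι → ℝ) : ∫ x, g x ∂μ = ∑ i, p i * g i := by
    rw [integral_finsetSum_measure fun i _ =>
      (integrable_dirac (by simp)).smul_measure ENNReal.ofReal_ne_top]
    refine Finset.sum_congr rfl fun i _ => ?_
    rw [integral_smul_measure, integral_dirac, ENNReal.toReal_ofReal (hp.1 i), smul_eq_mul]
  have hμ : IsProbabilityMeasure μ := by
    refine ⟨?_⟩
    simp only [μ, Measure.coe_finsetSum, Finset.sum_apply, Measure.smul_apply, measure_univ,
      smul_eq_mul, mul_one]
    rw [← ENNReal.ofReal_sum_of_nonneg fun i _ => hp.1 i, hp.2, ENNReal.ofReal_one]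
  have key := (ProbabilityTheory.hasSubgaussianMGF_of_mem_Icc (μ := μ) (X := f)
    (a := f i₀) (b := f i₀ + d) (by fun_prop)
    (ae_of_all _ fun i => ⟨hi₀ i, by linarith [hf i i₀]⟩)).mgf_le s
  rw [ProbabilityTheory.mgf, hint, hint] at key
  simp only [mul_sub, Real.exp_sub, mul_div_assoc'] at key
  rw [← Finset.sum_div, div_le_iff₀ (Real.exp_pos _), ← Real.exp_add] at key
  refine key.trans_eq ?_
  congr 1
  simp
  rw [abs_of_nonneg hd]
  ring

theorem hoeffding_pathExp [DecidableEq E] (hP : P ∈ Matrix.rowStochastic ℝ E) {m : ℕ} {ν : E → ℝ}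
    (hν : ν ∈ stdSimplex ℝ E) {g : List E → ℝ} {d : ℝ}
    (hg : ∀ u v, u.length = m → v.length = m → g u - g v ≤ d) (s : ℝ) :
    pathExp P m ν (fun l => Real.exp (s * g l)) ≤
      Real.exp (s * pathExp P m ν g + s ^ 2 * (d ^ 2 / 8)) := by
  simp only [pathExp_eq_sum]
  refine hoeffding_finite (p := fun w : Fin m → E => pathWeight P ν (List.ofFn w))
    (f := fun w => g (List.ofFn w)) ⟨fun w => pathWeight_nonneg hP hν _, ?_⟩
    (fun i j => hg _ _ (by simp) (by simp)) s
  have := pathExp_const hP m hν 1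
  rw [pathExp_eq_sum] at this
  simpa using this

end Path

end PMC

namespace PMC

/-! ### Functions of words that are Lipschitz for the Hamming distance -/

section Hamming

variable {E : Type*}

/-- Changing one letter of a word changes `g` by at most `c`. -/
def HammingLip (c : ℝ) (g : List E → ℝ) : Prop :=
  ∀ u v a b, |g (u ++ a :: v) - g (u ++ b :: v)| ≤ c

theorem HammingLip.append {c : ℝ} {g : List E → ℝ} (hg : HammingLip c g) (w : List E) :
    HammingLip c fun l => g (w ++ l) := fun u v a b => by
  simpa [List.append_assoc] using hg (w ++ u) v a b

theorem HammingLip.cons {c : ℝ} {g : List E → ℝ} (hg : HammingLip c g) (y : E) :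
    HammingLip c fun l => g (y :: l) := hg.append [y]

theorem HammingLip.sub_le {c : ℝ} {g : List E → ℝ} (hg : HammingLip c g) {u v : List E}
    (h : u.length = v.length) : g u - g v ≤ c * u.length := by
  induction u generalizing v g with
  | nil =>
    obtain rfl : v = [] := List.length_eq_zero_iff.mp h.symm
    simp
  | cons a u ih =>
    cases v with
    | nil => simp at h
    | cons b v =>
      have h1 := ih (hg.cons a) (v := v) (by simpa using h)
      have h2 := (abs_le.mp (hg [] v a b)).2
      simp only [List.nil_append] at h2
      simp only [List.length_cons]
      push_cast
      linarith

theorem HammingLip.iInf_cons [Finite E] [Nonempty E] {c : ℝ} {g : List E → ℝ}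
    (hg : HammingLip c g) : HammingLip c fun l => ⨅ y, g (y :: l) := by
  have key (u v : List E) (a b : E) :
      (⨅ y, g (y :: (u ++ a :: v))) - c ≤ ⨅ y, g (y :: (u ++ b :: v)) := by
    refine le_ciInf fun y => ?_
    have h1 : (⨅ y, g (y :: (u ++ a :: v))) ≤ g (y :: (u ++ a :: v)) :=
      ciInf_le (Set.finite_range _).bddBelow y
    have h2 := (abs_le.mp (hg (y :: u) v a b)).2
    simp only [List.cons_append] at h2
    linarith
  intro u v a b
  rw [abs_le]
  constructor
  · linarith [key u v b a]
  · linarith [key u v a b]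

end Hamming

/-! ### Total variation and mixing -/

section Mixing

variable {E : Type*} [Fintype E]

theorem tvDist_nonneg (p q : E → ℝ) : 0 ≤ tvDist p q := by
  unfold tvDist; positivity

/-- As `p - q` has total mass zero, `h` may be centred at `c / 2`, which halves its sup norm and
matches the factor `1 / 2` in `tvDist`. -/
theorem sum_sub_mul_le_tvDist {p q : E → ℝ} (hpq : ∑ y, p y = ∑ y, q y) {h : E → ℝ} {c : ℝ}
    (h0 : ∀ y, 0 ≤ h y) (h1 : ∀ y, h y ≤ c) :
    ∑ y, (p y - q y) * h y ≤ c * tvDist p q := by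
  have hz : ∑ y, (p y - q y) * (c / 2) = 0 := by
    rw [← Finset.sum_mul, Finset.sum_sub_distrib, hpq, sub_self, zero_mul]
  calc ∑ y, (p y - q y) * h y = ∑ y, (p y - q y) * (h y - c / 2) := by
        simp only [mul_sub, Finset.sum_sub_distrib] at hz ⊢
        rw [hz, sub_zero]
    _ ≤ ∑ y, |p y - q y| * (c / 2) := by
        refine Finset.sum_le_sum fun y _ => (le_abs_self _).trans ?_
        rw [abs_mul]
        gcongr
        rw [abs_le]
        constructor <;> linarith [h0 y, h1 y]
    _ = c * tvDist p q := by rw [tvDist, ← Finset.sum_mul]; ring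

/-- If every row of `P` is within `ε` of a common vector, then `P` contracts the total variation
distance by `2 * ε`. -/
theorem tvDist_vecMul_le {P : Matrix E E ℝ} {π : E → ℝ} {ε : ℝ}
    (hε : ∀ a, tvDist (P a) π ≤ ε) {p q : E → ℝ} (hpq : ∑ y, p y = ∑ y, q y) :
    tvDist (Matrix.vecMul p P) (Matrix.vecMul q P) ≤ 2 * ε * tvDist p q := by
  have hz : ∑ y, (p y - q y) = 0 := by rw [Finset.sum_sub_distrib, hpq, sub_self]
  have key (b : E) : |Matrix.vecMul p P b - Matrix.vecMul q P b| ≤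
      ∑ a, |p a - q a| * |P a b - π b| := by
    -- Zero total mass of `p - q` allows the same number `π b` to be subtracted from every row.
    have : Matrix.vecMul p P b - Matrix.vecMul q P b = ∑ a, (p a - q a) * (P a b - π b) := by
      simp only [mul_sub, Finset.sum_sub_distrib]
      rw [← Finset.sum_mul, hz, zero_mul, sub_zero]
      simp [Matrix.vecMul, dotProduct, sub_mul, Finset.sum_sub_distrib]
    rw [this]
    refine (Finset.abs_sum_le_sum_abs _ _).trans (Finset.sum_le_sum fun a _ => ?_)
    rw [abs_mul]
  calc tvDist (Matrix.vecMul p P) (Matrix.vecMul q P)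
      ≤ (1 / 2) * ∑ b, ∑ a, |p a - q a| * |P a b - π b| := by
        unfold tvDist
        gcongr with b
        exact key b
    _ = ∑ a, |p a - q a| * tvDist (P a) π := by
        rw [Finset.sum_comm, Finset.mul_sum]
        refine Finset.sum_congr rfl fun a _ => ?_
        rw [← Finset.mul_sum, tvDist]; ring
    _ ≤ ∑ a, |p a - q a| * ε := by gcongr with a; exact hε a
    _ = 2 * ε * tvDist p q := by rw [← Finset.sum_mul, tvDist]; ring

variable [DecidableEq E] {P : Matrix E E ℝ}

theorem tvDist_vecMul_le_self (hP : P ∈ Matrix.rowStochastic ℝ E) (p q : E → ℝ) :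
    tvDist (Matrix.vecMul p P) (Matrix.vecMul q P) ≤ tvDist p q := by
  unfold tvDist
  gcongr (1 / 2) * ?_
  calc ∑ b, |Matrix.vecMul p P b - Matrix.vecMul q P b|
      ≤ ∑ b, ∑ a, |p a - q a| * P a b := by
        refine Finset.sum_le_sum fun b _ => ?_
        simp only [Matrix.vecMul, dotProduct]
        rw [← Finset.sum_sub_distrib]
        refine (Finset.abs_sum_le_sum_abs _ _).trans (Finset.sum_le_sum fun a _ => ?_)
        rw [← sub_mul, abs_mul, abs_of_nonneg (Matrix.nonneg_of_mem_rowStochastic hP)]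
    _ = ∑ a, |p a - q a| := by
        rw [Finset.sum_comm]
        simp only [← Finset.mul_sum, Matrix.sum_row_of_mem_rowStochastic hP, mul_one]

theorem sum_vecMul (hP : P ∈ Matrix.rowStochastic ℝ E) (p : E → ℝ) :
    ∑ b, Matrix.vecMul p P b = ∑ a, p a := by
  simp only [Matrix.vecMul, dotProduct]
  rw [Finset.sum_comm]
  simp only [← Finset.mul_sum, Matrix.sum_row_of_mem_rowStochastic hP, mul_one]

theorem tvDist_vecMul_pow_le_self (hP : P ∈ Matrix.rowStochastic ℝ E) (p q : E → ℝ) (j : ℕ) :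
    tvDist (Matrix.vecMul p (P ^ j)) (Matrix.vecMul q (P ^ j)) ≤ tvDist p q :=
  tvDist_vecMul_le_self (pow_mem hP j) p q

/-- Within a block of `t` steps the distance does not grow, and each block multiplies it by at most
`2 * (1 / 4) = 1 / 2`. The geometric series `t (1 + 1/2 + 1/4 + ⋯)` gives `2 t`. -/
theorem sum_tvDist_vecMul_pow_le (hP : P ∈ Matrix.rowStochastic ℝ E) {π : E → ℝ} {t : ℕ}
    (ht : 0 < t) (hmix : ∀ a, tvDist (fun b => (P ^ t) a b) π ≤ 1 / 4) (m : ℕ) {p q : E → ℝ}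
    (hpq : ∑ y, p y = ∑ y, q y) :
    ∑ j ∈ Finset.range m, tvDist (Matrix.vecMul p (P ^ j)) (Matrix.vecMul q (P ^ j)) ≤
      2 * t * tvDist p q := by
  have hshort (k : ℕ) (p q : E → ℝ) :
      ∑ j ∈ Finset.range k, tvDist (Matrix.vecMul p (P ^ j)) (Matrix.vecMul q (P ^ j)) ≤
        k * tvDist p q := by
    refine (Finset.sum_le_sum fun j _ => tvDist_vecMul_pow_le_self hP p q j).trans ?_
    simp
  induction m using Nat.strong_induction_on generalizing p q with
  | _ m ih =>
    have h0 := tvDist_nonneg p q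
    rcases le_or_gt m t with hm | hm
    · refine (hshort m p q).trans ?_
      have : (m : ℝ) ≤ t := by exact_mod_cast hm
      have ht' : (0 : ℝ) ≤ t := by positivity
      nlinarith
    · obtain ⟨k, rfl⟩ := Nat.exists_eq_add_of_le hm.le
      rw [Finset.sum_range_add]
      have hsum : ∑ y, Matrix.vecMul p (P ^ t) y = ∑ y, Matrix.vecMul q (P ^ t) y := by
        rw [sum_vecMul (pow_mem hP t), sum_vecMul (pow_mem hP t), hpq]
      have h1 := ih k (by omega) hsum
      simp only [Matrix.vecMul_vecMul, ← pow_add] at h1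
      have h2 : tvDist (Matrix.vecMul p (P ^ t)) (Matrix.vecMul q (P ^ t)) ≤
          2 * (1 / 4) * tvDist p q := tvDist_vecMul_le hmix hpq
      have ht' : (0 : ℝ) ≤ t := by positivity
      have h3 := mul_le_mul_of_nonneg_left h2 (by positivity : (0 : ℝ) ≤ 2 * t)
      linarith [hshort t p q]

/-- Letters are peeled off one at a time: minimising over the first letter leaves a Lipschitz
function of the rest, at a cost `h` of the first letter with values in `[0, c]`. Each letter thus
contributes `c` times the distance between the two laws at its time. -/
theorem pathExp_sub_le_sum_tvDist (hP : P ∈ Matrix.rowStochastic ℝ E) {c : ℝ} (m : ℕ)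
    {g : List E → ℝ} (hg : HammingLip c g) {p q : E → ℝ} (hp : p ∈ stdSimplex ℝ E)
    (hq : q ∈ stdSimplex ℝ E) :
    pathExp P m p g - pathExp P m q g ≤
      c * ∑ j ∈ Finset.range m, tvDist (Matrix.vecMul p (P ^ j)) (Matrix.vecMul q (P ^ j)) := by
  have hne : Nonempty E := by
    by_contra h
    rw [not_nonempty_iff] at h
    simpa using hp.2
  induction m generalizing p q g with
  | zero => simp [pathExp_zero]
  | succ m ih =>
    set gm : List E → ℝ := fun l => ⨅ y, g (y :: l) with hgm
    set h : E → ℝ := fun y => pathExp P m (P y) (fun l => g (y :: l)) - pathExp P m (P y) gm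
    have hbdd (l : List E) : BddBelow (Set.range fun y => g (y :: l)) :=
      (Set.finite_range _).bddBelow
    have h0 (y : E) : 0 ≤ h y := sub_nonneg.mpr
      (pathExp_mono hP (row_mem_stdSimplex hP y) fun l _ => ciInf_le (hbdd l) y)
    have h1 (y : E) : h y ≤ c := by
      have : pathExp P m (P y) (fun l => g (y :: l)) ≤ pathExp P m (P y) (fun l => gm l + c) := by
        refine pathExp_mono hP (row_mem_stdSimplex hP y) fun l _ => ?_
        obtain ⟨z, hz⟩ := exists_eq_ciInf_of_finite (f := fun y => g (y :: l))
        have := (abs_le.mp (hg [] l y z)).2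
        simp only [List.nil_append] at this
        simp only [hgm, ← hz]
        linarith
      rw [pathExp_add, pathExp_const hP m (row_mem_stdSimplex hP y)] at this
      simp only [h]
      linarith
    have hdec (r : E → ℝ) (hr : r ∈ stdSimplex ℝ E) :
        pathExp P (m + 1) r g = ∑ y, r y * h y + pathExp P m (Matrix.vecMul r P) gm := by
      rw [pathExp_succ, ← sum_mul_pathExp hr.2, ← Finset.sum_add_distrib]
      refine Finset.sum_congr rfl fun y _ => ?_
      simp only [h]; ring
    have h2 := sum_sub_mul_le_tvDist (hp.2.trans hq.2.symm) h0 h1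
    simp only [sub_mul, Finset.sum_sub_distrib] at h2
    have h3 := ih hg.iInf_cons (vecMul_mem_stdSimplex hP hp) (vecMul_mem_stdSimplex hP hq)
    rw [hdec p hp, hdec q hq, Finset.sum_range_succ']
    simp only [Matrix.vecMul_vecMul, ← pow_succ'] at h3
    simp only [pow_zero, Matrix.vecMul_one]
    linarith

theorem pathExp_sub_le (hP : P ∈ Matrix.rowStochastic ℝ E) {π : E → ℝ} {t : ℕ}
    (ht : 0 < t) (hmix : ∀ a, tvDist (fun b => (P ^ t) a b) π ≤ 1 / 4) {c : ℝ} (hc : 0 ≤ c) (m : ℕ)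
    {g : List E → ℝ} (hg : HammingLip c g) {p q : E → ℝ} (hp : p ∈ stdSimplex ℝ E)
    (hq : q ∈ stdSimplex ℝ E) :
    pathExp P m p g - pathExp P m q g ≤ 2 * c * t := by
  have h1 := pathExp_sub_le_sum_tvDist hP m hg hp hq
  have h2 := sum_tvDist_vecMul_pow_le hP ht hmix m (hp.2.trans hq.2.symm)
  have h3 : tvDist p q ≤ 1 := by
    unfold tvDist
    have : ∑ b, |p b - q b| ≤ ∑ b, (p b + q b) := Finset.sum_le_sum fun b _ => by
      rw [abs_le]; constructor <;> linarith [hp.1 b, hq.1 b]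
    rw [Finset.sum_add_distrib, hp.2, hq.2] at this
    linarith
  have h4 : 2 * (t : ℝ) * tvDist p q ≤ 2 * t * 1 :=
    mul_le_mul_of_nonneg_left h3 (by positivity)
  have := mul_le_mul_of_nonneg_left (h2.trans h4) hc
  linarith

/-- The bound on the moment generating function behind McDiarmid's inequality for Markov chains. -/
theorem pathExp_exp_le (hP : P ∈ Matrix.rowStochastic ℝ E) {π : E → ℝ} {t : ℕ}
    (ht : 0 < t) (hmix : ∀ a, tvDist (fun b => (P ^ t) a b) π ≤ 1 / 4) {c : ℝ} (hc : 0 ≤ c) (m : ℕ)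
    {g : List E → ℝ} (hg : HammingLip c g) {ν : E → ℝ} (hν : ν ∈ stdSimplex ℝ E) (s : ℝ) :
    pathExp P m ν (fun l => Real.exp (s * g l)) ≤
      Real.exp (s * pathExp P m ν g + s ^ 2 * ((3 * c) ^ 2 * t * m / 8)) := by
  have ht' : (0 : ℝ) ≤ t := by positivity
  induction m using Nat.strong_induction_on generalizing g ν with
  | _ m ih =>
    rcases le_or_gt m t with hm | hm
    · have hmt : (m : ℝ) ≤ t := by exact_mod_cast hm
      -- A last block of length `m ≤ t` needs no mixing: its oscillation is at most `c m`, and `(c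
      -- m)² ≤ (3 c)² t m`.
      refine (hoeffding_pathExp hP hν (d := c * m) (fun u v hu hv => ?_) s).trans ?_
      · have := hg.sub_le (hu.trans hv.symm)
        rwa [hu] at this
      · gcongr
        rw [mul_pow, mul_pow, mul_assoc ((3 : ℝ) ^ 2 * c ^ 2), mul_comm ((3 : ℝ) ^ 2), mul_assoc]
        gcongr
        have : (m : ℝ) * m ≤ t * m := by gcongr
        nlinarith [mul_nonneg ht' (Nat.cast_nonneg (α := ℝ) m)]
    · obtain ⟨k, rfl⟩ := Nat.exists_eq_add_of_le hm.le
      set V : List E → ℝ := fun u => pathExp P k (nextLaw P ν u) fun l => g (u ++ l) with hV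
      -- The oscillation `3 c t` is `2 c t` for the changed law of the future plus `c t` for the `t`
      -- changed letters.
      have hosc (u v : List E) (hu : u.length = t) (hv : v.length = t) :
          V u - V v ≤ 3 * c * t := by
        have h1 := pathExp_sub_le hP ht hmix hc k (hg.append u) (nextLaw_mem_stdSimplex hP hν u)
          (nextLaw_mem_stdSimplex hP hν v)
        have h2 : pathExp P k (nextLaw P ν v) (fun l => g (u ++ l)) ≤
            pathExp P k (nextLaw P ν v) (fun l => g (v ++ l) + c * t) := by
          refine pathExp_mono hP (nextLaw_mem_stdSimplex hP hν v) fun l _ => ?_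
          have hl : HammingLip c fun u => g (u ++ l) := fun a b x y => by
            simpa using hg a (b ++ l) x y
          have := hl.sub_le (hu.trans hv.symm)
          rw [hu] at this
          linarith
        rw [pathExp_add, pathExp_const hP k (nextLaw_mem_stdSimplex hP hν v)] at h2
        simp only [hV]
        linarith
      have hin (u : List E) : pathExp P k (nextLaw P ν u) (fun l => Real.exp (s * g (u ++ l))) ≤
          Real.exp (s ^ 2 * ((3 * c) ^ 2 * t * k / 8)) * Real.exp (s * V u) := by
        rw [← Real.exp_add, add_comm]
        exact ih k (by omega) (hg.append u) (nextLaw_mem_stdSimplex hP hν u)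
      rw [pathExp_split, pathExp_split]
      refine (pathExp_mono hP hν fun u _ => hin u).trans ?_
      rw [pathExp_const_mul]
      refine (mul_le_mul_of_nonneg_left (hoeffding_pathExp hP hν hosc s)
        (Real.exp_nonneg _)).trans_eq ?_
      rw [← Real.exp_add]
      congr 1
      push_cast
      ring

/-! ### Convergence to the stationary distribution -/

/-- The return times of a state form a semigroup with gcd `1`, so they contain all large integers. A
common exponent leaves time to loop at `a` before following a path to `b`. -/
theorem exists_pow_pos (hP : P ∈ Matrix.rowStochastic ℝ E) (hirr : P.IsIrreducible)
    (haper : IsAperiodic P) : ∃ N : ℕ, ∀ a b, 0 < (P ^ N) a b := by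
  have hnn : ∀ i j, 0 ≤ P i j := fun _ _ => Matrix.nonneg_of_mem_rowStochastic hP
  have hpow (k : ℕ) (i j : E) : 0 ≤ (P ^ k) i j :=
    Matrix.nonneg_of_mem_rowStochastic (pow_mem hP k)
  have hmul {k l : ℕ} {a b c : E} (h1 : 0 < (P ^ k) a b) (h2 : 0 < (P ^ l) b c) :
      0 < (P ^ (k + l)) a c := by
    rw [pow_add, Matrix.mul_apply]
    exact (mul_pos h1 h2).trans_le (Finset.single_le_sum
      (f := fun j => (P ^ k) a j * (P ^ l) j c)
      (fun j _ => mul_nonneg (hpow k a j) (hpow l j c)) (Finset.mem_univ b))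
  have hreturn (a : E) : ∃ n, ∀ m ≥ n, 0 < (P ^ m) a a := by
    let s : Set ℕ := {k | 0 < k ∧ 0 < (P ^ k) a a}
    have hgcd : Nat.setGcd s = 1 :=
      haper a _ fun k hk h => Nat.setGcd_dvd_of_mem (s := s) ⟨hk, h⟩
    obtain ⟨n, hn⟩ := Nat.exists_mem_closure_of_ge s
    refine ⟨n, fun m hm => ?_⟩
    have hmem := hn m hm (by rw [hgcd]; exact one_dvd m)
    clear hm
    induction hmem using AddSubmonoid.closure_induction with
    | mem x hx => exact hx.2
    | zero => simp
    | add x y _ _ hx hy => exact hmul hx hy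
  choose n hn using hreturn
  choose k _ hk using (Matrix.isIrreducible_iff_exists_pow_pos hnn).mp hirr
  refine ⟨∑ a, n a + ∑ a, ∑ b, k a b, fun a b => ?_⟩
  have h1 : n a ≤ ∑ a, n a := Finset.single_le_sum (fun _ _ => Nat.zero_le _) (Finset.mem_univ a)
  have h2 : k a b ≤ ∑ a, ∑ b, k a b :=
    (Finset.single_le_sum (f := fun b => k a b) (fun _ _ => Nat.zero_le _)
      (Finset.mem_univ b)).trans
      (Finset.single_le_sum (f := fun a => ∑ b, k a b) (fun _ _ => Nat.zero_le _)
        (Finset.mem_univ a))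
  have := hmul (hn a (∑ a, n a + ∑ a, ∑ b, k a b - k a b) (by omega)) (hk a b)
  rwa [Nat.sub_add_cancel (by omega)] at this

/-- A transition matrix with positive entries is a strict contraction in total variation. -/
theorem exists_tvDist_vecMul_le [Nonempty E] (hP : P ∈ Matrix.rowStochastic ℝ E)
    (hpos : ∀ a b, 0 < P a b) :
    ∃ θ : ℝ, 0 ≤ θ ∧ θ < 1 ∧ ∀ p q : E → ℝ, ∑ y, p y = ∑ y, q y →
      tvDist (Matrix.vecMul p P) (Matrix.vecMul q P) ≤ θ * tvDist p q := by
  obtain ⟨x, hx⟩ := Finite.exists_min fun x : E × E => P x.1 x.2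
  set α := P x.1 x.2
  have hα : 0 < α := hpos _ _
  have hrow (a : E) : ∑ b, |P a b - α| = 1 - Fintype.card E * α := by
    rw [← Matrix.sum_row_of_mem_rowStochastic hP a]
    simp only [abs_of_nonneg (sub_nonneg.mpr (hx (a, _))), Finset.sum_sub_distrib]
    simp
  -- The vector compared with every row is the constant `α`, which need not have mass `1`;
  -- `tvDist_vecMul_le` does not ask for that.
  have h2 (a : E) : tvDist (P a) (fun _ => α) ≤ (1 - Fintype.card E * α) / 2 := by
    rw [tvDist, hrow]; linarith
  refine ⟨1 - Fintype.card E * α, ?_, ?_, fun p q hpq => ?_⟩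
  · rw [← hrow x.1]; positivity
  · have : (0 : ℝ) < Fintype.card E := by exact_mod_cast Fintype.card_pos
    linarith [mul_pos this hα]
  · refine (tvDist_vecMul_le h2 hpq).trans_eq ?_
    ring

theorem exists_mixing [Nonempty E] (hP : P ∈ Matrix.rowStochastic ℝ E) (hirr : P.IsIrreducible)
    (haper : IsAperiodic P) {π : E → ℝ} (hπ : π ∈ stdSimplex ℝ E)
    (hstat : Matrix.vecMul π P = π) {ε : ℝ} (hε : 0 < ε) :
    ∃ t : ℕ, ∀ a : E, tvDist (fun b => (P ^ t) a b) π ≤ ε := by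
  obtain ⟨N, hN⟩ := exists_pow_pos hP hirr haper
  obtain ⟨θ, h0, h1, hθ⟩ := exists_tvDist_vecMul_le (pow_mem hP N) hN
  have hstatN (k : ℕ) : Matrix.vecMul π (P ^ k) = π := by
    induction k with
    | zero => simp
    | succ k ih => rw [pow_succ, ← Matrix.vecMul_vecMul, ih, hstat]
  have hiter (k : ℕ) (a : E) : tvDist ((P ^ (N * k)) a) π ≤ θ ^ k * 1 := by
    induction k with
    | zero =>
      have hr := row_mem_stdSimplex (pow_mem hP (N * 0)) a
      unfold tvDist
      have : ∑ b, |(P ^ (N * 0)) a b - π b| ≤ ∑ b, ((P ^ (N * 0)) a b + π b) :=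
        Finset.sum_le_sum fun b _ => by
          rw [abs_le]; constructor <;> linarith [hr.1 b, hπ.1 b]
      rw [Finset.sum_add_distrib, hr.2, hπ.2] at this
      linarith
    | succ k ih =>
      have h3 := hθ ((P ^ (N * k)) a) π
        ((row_mem_stdSimplex (pow_mem hP (N * k)) a).2.trans hπ.2.symm)
      have h4 : Matrix.vecMul ((P ^ (N * k)) a) (P ^ N) = (P ^ (N * (k + 1))) a := by
        rw [mul_add, mul_one, pow_add]; rfl
      rw [h4, hstatN] at h3
      refine h3.trans ?_
      rw [pow_succ', mul_assoc]
      gcongr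
  obtain ⟨k, hk⟩ := exists_pow_lt_of_lt_one hε h1
  exact ⟨N * k, fun a => (hiter k a).trans (by linarith)⟩

end Mixing

end PMC

namespace PMC

/-! ### The optimal score is Lipschitz -/

section ScoreLip

variable {𝔸 : Type*} [Finite 𝔸] (S : 𝔸 → 𝔸 → ℝ) (δ : ℝ)

theorem abs_sub_le_maxChange_right (u v w : 𝔸) : |S u v - S u w| ≤ maxChange S :=
  (le_max_left _ _).trans (le_ciSup (f := fun p : 𝔸 × 𝔸 × 𝔸 =>
    max |S p.1 p.2.1 - S p.1 p.2.2| |S p.2.1 p.1 - S p.2.2 p.1|)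
    (Set.finite_range _).bddAbove (u, v, w))

theorem abs_sub_le_maxChange_left (u v w : 𝔸) : |S v u - S w u| ≤ maxChange S :=
  (le_max_right _ _).trans (le_ciSup (f := fun p : 𝔸 × 𝔸 × 𝔸 =>
    max |S p.1 p.2.1 - S p.1 p.2.2| |S p.2.1 p.1 - S p.2.2 p.1|)
    (Set.finite_range _).bddAbove (u, v, w))

theorem maxChange_nonneg [Nonempty 𝔸] : 0 ≤ maxChange S := by
  obtain ⟨a⟩ := ‹Nonempty 𝔸›
  exact (abs_nonneg _).trans (abs_sub_le_maxChange_right S a a a)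

variable {n : ℕ}

/-- Both `ρ` and `τ` are injective, so position `i` enters at most once through its first letter and
at most once through its second, each time at a cost of at most `maxChange S`. -/
theorem alignmentScore_update_le [DecidableEq 𝔸] [Nonempty 𝔸] (z : Fin n → 𝔸 × 𝔸) (i : Fin n)
    (a : 𝔸 × 𝔸) (al : Alignment n) :
    alignmentScore S δ (Function.update z i a) al ≤
      alignmentScore S δ z al + 2 * maxChange S := by
  have hΔ := maxChange_nonneg S
  set z' := Function.update z i a with hz'
  have hone (σ : Fin al.k ↪o Fin n) :
      ∑ j, (if σ j = i then maxChange S else 0) ≤ maxChange S := by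
    by_cases h : ∃ j, σ j = i
    · obtain ⟨j, rfl⟩ := h
      simp
    · push Not at h
      simp [h, hΔ]
  have hterm (j : Fin al.k) :
      S (z' (al.ρ j)).1 (z' (al.τ j)).2 ≤ S (z (al.ρ j)).1 (z (al.τ j)).2 +
        ((if al.ρ j = i then maxChange S else 0) + if al.τ j = i then maxChange S else 0) := by
    have h1 : S (z' (al.ρ j)).1 (z' (al.τ j)).2 - S (z (al.ρ j)).1 (z' (al.τ j)).2 ≤
        if al.ρ j = i then maxChange S else 0 := by
      split_ifs with h
      · exact (le_abs_self _).trans (abs_sub_le_maxChange_left S _ _ _)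
      · simp [hz', h]
    have h2 : S (z (al.ρ j)).1 (z' (al.τ j)).2 - S (z (al.ρ j)).1 (z (al.τ j)).2 ≤
        if al.τ j = i then maxChange S else 0 := by
      split_ifs with h
      · exact (le_abs_self _).trans (abs_sub_le_maxChange_right S _ _ _)
      · simp [hz', h]
    linarith
  have := Finset.sum_le_sum fun j (_ : j ∈ Finset.univ) => hterm j
  rw [Finset.sum_add_distrib, Finset.sum_add_distrib] at this
  unfold alignmentScore
  linarith [hone al.ρ, hone al.τ]

-- Needed because the supremum of an unbounded real family would be the default value `0`.
omit [Finite 𝔸] in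
theorem bddAbove_alignmentScore (z : Fin n → 𝔸 × 𝔸) :
    BddAbove (Set.range (alignmentScore S δ z)) := by
  obtain ⟨M, hM⟩ := (Set.finite_range fun p : Fin n × Fin n => S (z p.1).1 (z p.2).2).bddAbove
  refine ⟨n * |M| + |δ| * n, ?_⟩
  rintro _ ⟨al, rfl⟩
  have hk : (al.k : ℝ) ≤ n := by
    exact_mod_cast (by simpa using Fintype.card_le_of_embedding al.ρ.toEmbedding)
  have h1 : ∑ i : Fin al.k, S (z (al.ρ i)).1 (z (al.τ i)).2 ≤ ∑ i : Fin al.k, |M| :=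
    Finset.sum_le_sum fun i _ => (hM ⟨(al.ρ i, al.τ i), rfl⟩).trans (le_abs_self M)
  rw [Finset.sum_const, Finset.card_univ, Fintype.card_fin, nsmul_eq_mul] at h1
  have h2 : δ * ((n : ℝ) - al.k) ≤ |δ| * n := by
    have h0 : (0 : ℝ) ≤ al.k := by positivity
    calc δ * ((n : ℝ) - al.k) ≤ |δ| * ((n : ℝ) - al.k) := by
          exact mul_le_mul_of_nonneg_right (le_abs_self δ) (by linarith)
      _ ≤ |δ| * n := by gcongr; linarith
  have h3 : (al.k : ℝ) * |M| ≤ n * |M| := by gcongr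
  unfold alignmentScore
  linarith

theorem abs_score_update_sub_le [DecidableEq 𝔸] [Nonempty 𝔸] (z : Fin n → 𝔸 × 𝔸) (i : Fin n)
    (a : 𝔸 × 𝔸) :
    |score S δ (Function.update z i a) - score S δ z| ≤ 2 * maxChange S := by
  have key (z : Fin n → 𝔸 × 𝔸) (a : 𝔸 × 𝔸) :
      score S δ (Function.update z i a) ≤ score S δ z + 2 * maxChange S := by
    have : Nonempty (Alignment n) := ⟨⟨n, RelEmbedding.refl _, RelEmbedding.refl _⟩⟩
    refine ciSup_le fun al => (alignmentScore_update_le S δ z i a al).trans ?_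
    gcongr
    exact le_ciSup (bddAbove_alignmentScore S δ z) al
  rw [abs_le]
  constructor
  · have := key (Function.update z i a) (z i)
    rw [Function.update_idem, Function.update_eq_self] at this
    linarith
  · linarith [key z a]

end ScoreLip

/-! ### Functions of tuples as functions of words -/

section OfList

variable {E : Type*} {n : ℕ}

/-- The first `n` letters of a word, padded with `e`. -/
def ofList (e : E) (n : ℕ) (l : List E) : Fin n → E := fun i => l.getD i e

theorem ofList_ofFn (e : E) (w : Fin n → E) : ofList e n (List.ofFn w) = w := by
  ext i; simp [ofList]

theorem ofList_set [DecidableEq E] (e : E) (l : List E) (hl : l.length = n) (j : Fin n) (a : E) :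
    ofList e n (l.set j a) = Function.update (ofList e n l) j a := by
  ext i
  have := i.isLt
  by_cases h : i = j
  · subst h
    simp [ofList, hl]
  · have h' : (j : ℕ) ≠ i := fun h' => h (Fin.ext h'.symm)
    simp [ofList, h, List.getElem?_set_ne h']

theorem ofList_append_cons [DecidableEq E] (e : E) (u v : List E) (a b : E) :
    ofList e n (u ++ a :: v) =
      if h : u.length < n then Function.update (ofList e n (u ++ b :: v)) ⟨u.length, h⟩ a
      else ofList e n (u ++ b :: v) := by
  ext i
  have hi := i.isLt
  rcases lt_trichotomy (i : ℕ) u.length with h | h | h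
  · have : ∀ h : u.length < n, i ≠ ⟨u.length, h⟩ := fun _ h' => by simp [h'] at h
    split_ifs with hn
    · simp [ofList, this, List.getElem?_append_left h]
    · simp [ofList, List.getElem?_append_left h]
  · obtain ⟨i, hi'⟩ := i
    subst h
    rw [dif_pos hi']
    simp [ofList]
  · have hn : u.length < n := h.trans hi
    have : i ≠ ⟨u.length, hn⟩ := fun h' => by simp [h'] at h
    obtain ⟨k, hk⟩ := Nat.exists_eq_add_of_lt h
    rw [dif_pos hn, Function.update_of_ne this]
    have hs : (i : ℕ) - u.length = k + 1 := by omega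
    simp [ofList, List.getElem?_append_right h.le, hs]

theorem hammingLip_ofList [DecidableEq E] (e : E) {c : ℝ} (hc : 0 ≤ c) {G : (Fin n → E) → ℝ}
    (hG : ∀ z i a, |G (Function.update z i a) - G z| ≤ c) :
    HammingLip c fun l => G (ofList e n l) := fun u v a b => by
  simp only [ofList_append_cons e u v a b]
  split_ifs with h
  · exact hG _ _ _
  · simpa using hc

end OfList

/-! ### The law of a stationary Markov chain -/

section Law

variable {E : Type*} [Fintype E] [DecidableEq E] [MeasurableSpace E] [MeasurableSingletonClass E]
  {Ω : Type*} [MeasurableSpace Ω] {μ : Measure Ω} [IsProbabilityMeasure μ] {P : Matrix E E ℝ}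
  {Z : ℕ → Ω → E}

/-- The law of the first letter of the chain. -/
noncomputable def initLaw (μ : Measure Ω) (Z : ℕ → Ω → E) : E → ℝ := fun a => μ.real {ω | Z 0 ω = a}

omit [MeasurableSpace E] [MeasurableSingletonClass E] [Fintype E] [DecidableEq E] in
theorem pathWeight_append_singleton (ν : E → ℝ) (u : List E) (b : E) :
    pathWeight P ν (u ++ [b]) = pathWeight P ν u * nextLaw P ν u b := by
  induction u generalizing ν with
  | nil => simp [pathWeight, nextLaw]
  | cons y u ih => simp [pathWeight, nextLaw, ih, mul_assoc]

omit [MeasurableSpace E] [MeasurableSingletonClass E] [Fintype E] [DecidableEq E] in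
theorem nextLaw_append_singleton (ν : E → ℝ) (u : List E) (b : E) :
    nextLaw P ν (u ++ [b]) = P b := by
  induction u generalizing ν with
  | nil => simp [nextLaw]
  | cons y u ih => simp [nextLaw, ih]

namespace IsStationaryMarkovChain

omit [MeasurableSingletonClass E] in
theorem real_eq_pathWeight (hZ : IsStationaryMarkovChain μ P Z) (n : ℕ) (x : ℕ → E) :
    μ.real {ω | ∀ i < n, Z i ω = x i} = pathWeight P (initLaw μ Z) ((List.range n).map x) := by
  induction n with
  | zero => simp [pathWeight]
  | succ n ih =>
    rw [List.range_succ, List.map_append, List.map_singleton, pathWeight_append_singleton, ← ih]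
    cases n with
    | zero => simp [nextLaw, initLaw]
    | succ n =>
      rw [List.range_succ, List.map_append, List.map_singleton, nextLaw_append_singleton]
      have := hZ.markov n x (x (n + 1))
      simp only [← Nat.lt_succ_iff, Nat.succ_eq_add_one] at this
      rw [← this]
      congr 1
      ext ω
      simp only [Set.mem_ofPred_eq]
      constructor
      · exact fun h => ⟨fun i hi => h i (by omega), h _ (by omega)⟩
      · rintro ⟨h1, h2⟩ i hi
        rcases Nat.lt_succ_iff_lt_or_eq.mp hi with h | rfl
        · exact h1 i h
        · exact h2

omit [DecidableEq E] [Fintype E] [MeasurableSingletonClass E] [IsProbabilityMeasure μ] in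
theorem measurable_word [Fintype E] [DecidableEq E] (hZ : IsStationaryMarkovChain μ P Z) (n : ℕ) :
    Measurable fun ω => fun i : Fin n => Z i ω :=
  measurable_pi_lambda _ fun i => hZ.measurable i

theorem integrable_word (hZ : IsStationaryMarkovChain μ P Z) {n : ℕ} (G : (Fin n → E) → ℝ) :
    Integrable (fun ω => G fun i => Z i ω) μ := by
  have := Measure.isProbabilityMeasure_map (μ := μ) (hZ.measurable_word n).aemeasurable
  exact (Integrable.of_finite (f := G)).comp_measurable (hZ.measurable_word n)

/-- The bridge from the probability space to finite sums. The letter `e` is mere padding: only words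
of length `n` carry weight. -/
theorem integral_eq_pathExp (hZ : IsStationaryMarkovChain μ P Z) {n : ℕ} (G : (Fin n → E) → ℝ)
    (e : E) :
    ∫ ω, G (fun i => Z i ω) ∂μ = pathExp P n (initLaw μ Z) fun l => G (ofList e n l) := by
  have hm := hZ.measurable_word n
  have := Measure.isProbabilityMeasure_map (μ := μ) hm.aemeasurable
  rw [← integral_map (φ := fun ω => fun i : Fin n => Z i ω) hm.aemeasurable
    (StronglyMeasurable.of_discrete.aestronglyMeasurable), integral_fintype Integrable.of_finite,
    pathExp_eq_sum]
  refine Finset.sum_congr rfl fun w _ => ?_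
  rw [ofList_ofFn, smul_eq_mul, map_measureReal_apply hm (measurableSet_singleton _)]
  congr 1
  have h1 : List.ofFn w = (List.range n).map (fun i => (List.ofFn w).getD i e) := by
    refine List.ext_getElem (by simp) fun i h1 h2 => ?_
    have : i < n := by simpa using h1
    simp [this]
  rw [h1, ← hZ.real_eq_pathWeight]
  congr 1
  ext ω
  simp only [Set.mem_preimage, Set.mem_singleton_iff, Set.mem_ofPred_eq, funext_iff]
  constructor
  · intro h i hi
    simpa [hi] using h ⟨i, hi⟩
  · intro h i
    simpa using h i i.isLt

omit [DecidableEq E] [Fintype E] [MeasurableSingletonClass E] in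
theorem nonempty_state [Fintype E] [DecidableEq E] (_hZ : IsStationaryMarkovChain μ P Z) : Nonempty E := by
  obtain ⟨ω⟩ : Nonempty Ω := nonempty_of_isProbabilityMeasure μ
  exact ⟨Z 0 ω⟩

theorem initLaw_mem_stdSimplex (hZ : IsStationaryMarkovChain μ P Z) :
    initLaw μ Z ∈ stdSimplex ℝ E := by
  obtain ⟨e⟩ := hZ.nonempty_state
  refine ⟨fun _ => measureReal_nonneg, ?_⟩
  have := hZ.integral_eq_pathExp (n := 1) (fun _ => 1) e
  simpa [pathExp] using this.symm

theorem real_eq_pathExp (hZ : IsStationaryMarkovChain μ P Z) {n : ℕ} (p : (Fin n → E) → Prop)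
    [DecidablePred p] (e : E) :
    μ.real {ω | p fun i => Z i ω} =
      pathExp P n (initLaw μ Z) fun l => if p (ofList e n l) then 1 else 0 := by
  rw [← hZ.integral_eq_pathExp (fun w => if p w then 1 else 0) e,
    ← integral_indicator_one]
  · refine integral_congr_ae (ae_of_all _ fun ω => ?_)
    simp [Set.indicator_apply]
  · exact hZ.measurable_word n (Set.toFinite {w | p w}).measurableSet

theorem initLaw_vecMul (hZ : IsStationaryMarkovChain μ P Z) :
    Matrix.vecMul (initLaw μ Z) P = initLaw μ Z := by
  obtain ⟨e⟩ := hZ.nonempty_state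
  ext b
  rw [initLaw, ← hZ.stationary 1 b]
  have := hZ.real_eq_pathExp (n := 2) (fun w => w 1 = b) e
  simp only [Fin.isValue, Fin.val_one] at this
  rw [this]
  simp [pathExp, ofList, Matrix.vecMul, dotProduct, initLaw]

end IsStationaryMarkovChain

end Law

end PMC

namespace PMC

/-! ### Moments from a sub-Gaussian tail -/

section Moments

variable {Ω : Type*} [MeasurableSpace Ω] {μ : Measure Ω} [IsProbabilityMeasure μ]

theorem integrableOn_exp_neg_mul_rpow {p : ℝ} (hp : 0 < p) :
    IntegrableOn (fun u : ℝ => Real.exp (-u) * u ^ (p - 1)) (Set.Ioi (Real.log 2)) :=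
  (Real.GammaIntegral_convergent hp).mono_set
    (Set.Ioi_subset_Ioi (Real.log_nonneg (by norm_num)))

/-- Layer-cake formula: the tail is bounded by `1` up to `log 2`, where `2 * exp (-t)` drops to `1`,
and by `2 * exp (-t)` beyond. -/
theorem integral_rpow_le_of_exp_tail {U : Ω → ℝ} (hU : ∀ ω, 0 ≤ U ω) (hm : AEMeasurable U μ)
    (htail : ∀ t : ℝ, 0 < t → μ.real {ω | t ≤ U ω} ≤ 2 * Real.exp (-t)) {p : ℝ} (hp : 0 < p) :
    ∫ ω, U ω ^ p ∂μ ≤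
      Real.log 2 ^ p + 2 * p * ∫ u in Set.Ioi (Real.log 2), Real.exp (-u) * u ^ (p - 1) := by
  have hlog : 0 ≤ Real.log 2 := Real.log_nonneg (by norm_num)
  have hJ : 0 ≤ ∫ u in Set.Ioi (Real.log 2), Real.exp (-u) * u ^ (p - 1) :=
    setIntegral_nonneg measurableSet_Ioi fun u hu =>
      mul_nonneg (Real.exp_nonneg _) (Real.rpow_nonneg (hlog.trans (le_of_lt hu)) _)
  have h1 : ∫⁻ t in Set.Ioc 0 (Real.log 2), μ {a | t ≤ U a} * ENNReal.ofReal (t ^ (p - 1)) ≤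
      ENNReal.ofReal (Real.log 2 ^ p / p) := by
    calc ∫⁻ t in Set.Ioc 0 (Real.log 2), μ {a | t ≤ U a} * ENNReal.ofReal (t ^ (p - 1))
        ≤ ∫⁻ t in Set.Ioc 0 (Real.log 2), ENNReal.ofReal (t ^ (p - 1)) :=
          lintegral_mono fun t => mul_le_of_le_one_left (zero_le) prob_le_one
      _ = ENNReal.ofReal (∫ t in Set.Ioc 0 (Real.log 2), t ^ (p - 1)) := by
          rw [ofReal_integral_eq_lintegral_ofReal]
          · exact (intervalIntegrable_iff_integrableOn_Ioc_of_le hlog).mp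
              (intervalIntegral.intervalIntegrable_rpow' (by linarith))
          · filter_upwards [ae_restrict_mem measurableSet_Ioc] with t ht
            exact Real.rpow_nonneg ht.1.le _
      _ = ENNReal.ofReal (Real.log 2 ^ p / p) := by
          rw [← intervalIntegral.integral_of_le hlog, integral_rpow (Or.inl (by linarith))]
          simp [Real.zero_rpow hp.ne']
  have h2 : ∫⁻ t in Set.Ioi (Real.log 2), μ {a | t ≤ U a} * ENNReal.ofReal (t ^ (p - 1)) ≤
      ENNReal.ofReal (2 * ∫ u in Set.Ioi (Real.log 2), Real.exp (-u) * u ^ (p - 1)) := by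
    rw [← integral_const_mul, ofReal_integral_eq_lintegral_ofReal
      ((integrableOn_exp_neg_mul_rpow hp).const_mul 2)]
    · refine setLIntegral_mono' measurableSet_Ioi fun t ht => ?_
      have ht0 : 0 < t := lt_of_le_of_lt hlog ht
      rw [← mul_assoc, ENNReal.ofReal_mul (by positivity)]
      gcongr
      rw [← ofReal_measureReal]
      exact ENNReal.ofReal_le_ofReal (htail t ht0)
    · filter_upwards [ae_restrict_mem measurableSet_Ioi] with t ht
      have ht0 : 0 < t := lt_of_le_of_lt hlog ht
      positivity
  have h3 : ∫⁻ ω, ENNReal.ofReal (U ω ^ p) ∂μ ≤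
      ENNReal.ofReal p * (ENNReal.ofReal (Real.log 2 ^ p / p) +
        ENNReal.ofReal (2 * ∫ u in Set.Ioi (Real.log 2), Real.exp (-u) * u ^ (p - 1))) := by
    rw [lintegral_rpow_eq_lintegral_meas_le_mul μ (ae_of_all _ hU) hm hp,
      ← Set.Ioc_union_Ioi_eq_Ioi hlog]
    gcongr
    exact (lintegral_union_le _ _ _).trans (add_le_add h1 h2)
  rw [← ENNReal.ofReal_add (by positivity) (by positivity), ← ENNReal.ofReal_mul hp.le] at h3
  rw [integral_eq_lintegral_of_nonneg_ae (ae_of_all _ fun ω => Real.rpow_nonneg (hU ω) p)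
    (hm.pow_const p).aestronglyMeasurable]
  refine (ENNReal.toReal_le_of_le_ofReal (by positivity) h3).trans_eq ?_
  field_simp

end Moments

/-! ### Concentration of the score -/

section Concentration

variable {𝔸 : Type*} [Fintype 𝔸] [DecidableEq 𝔸] [MeasurableSpace 𝔸]
    [MeasurableSingletonClass 𝔸] {Ω : Type*} [MeasurableSpace Ω] {μ : Measure Ω}
    [IsProbabilityMeasure μ] {S : 𝔸 → 𝔸 → ℝ} {δ : ℝ}
    {P : Matrix (𝔸 × 𝔸) (𝔸 × 𝔸) ℝ} {Z : ℕ → Ω → 𝔸 × 𝔸}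

omit [MeasurableSpace 𝔸] [MeasurableSingletonClass 𝔸] in
theorem hammingLip_score [Nonempty 𝔸] (e : 𝔸 × 𝔸) (n : ℕ) :
    HammingLip (2 * maxChange S) fun l => score S δ (ofList e n l) :=
  hammingLip_ofList e (by linarith [maxChange_nonneg S]) (abs_score_update_sub_le S δ)

/-- Convergence to the stationary law makes the set of admissible times nonempty, so `mixingTime` is
a true minimum and not the default `sInf ∅ = 0`. -/
theorem mixingTime_spec (hZ : IsStationaryMarkovChain μ P Z) (hirr : P.IsIrreducible)
    (haper : IsAperiodic P) {ε : ℝ} (hε : 0 < ε) (a : 𝔸 × 𝔸) :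
    tvDist (fun b => (P ^ mixingTime P (initLaw μ Z) ε) a b) (initLaw μ Z) ≤ ε :=
  have := hZ.nonempty_state
  Nat.sInf_mem (s := {t : ℕ | ∀ a, tvDist (fun b => (P ^ t) a b) (initLaw μ Z) ≤ ε})
    (exists_mixing hZ.stochastic hirr haper hZ.initLaw_mem_stdSimplex hZ.initLaw_vecMul hε) a

omit [MeasurableSpace 𝔸] [MeasurableSingletonClass 𝔸] [IsProbabilityMeasure μ] in
theorem constF_eq (S : 𝔸 → 𝔸 → ℝ) : constF μ S P Z =
    32 * maxChange S ^ 2 * (mixingTime P (initLaw μ Z) (1 / 4) : ℝ) := rfl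

omit [MeasurableSpace 𝔸] [MeasurableSingletonClass 𝔸] [IsProbabilityMeasure μ] in
theorem constF_nonneg : 0 ≤ constF μ S P Z := by
  rw [constF_eq]; positivity

/-- Either the Lipschitz constant is `0`, or the mixing time is `0`. In the latter case every point
mass is within `1 / 4` of the stationary law, so every state has mass at least `3 / 4` and there is
only one state. In both cases the score is constant. -/
theorem Wn_eq_zero (hZ : IsStationaryMarkovChain μ P Z) (hirr : P.IsIrreducible)
    (haper : IsAperiodic P) (hF : constF μ S P Z = 0) (n : ℕ) (ω : Ω) :
    Wn μ S δ Z n ω = 0 := by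
  have hne := hZ.nonempty_state
  have hne' : Nonempty 𝔸 := hne.map Prod.fst
  obtain ⟨e⟩ := hne
  have hconst (ω ω' : Ω) : Ln S δ Z n ω ≤ Ln S δ Z n ω' := by
    rw [constF_eq] at hF
    rcases mul_eq_zero.mp hF with h | h
    · have hΔ : maxChange S = 0 := by simpa using h
      have := (hammingLip_score (S := S) (δ := δ) e n).sub_le
        (u := List.ofFn fun i : Fin n => Z i ω) (v := List.ofFn fun i : Fin n => Z i ω')
        (by simp)
      rw [hΔ] at this
      simp only [ofList_ofFn] at this
      simpa [Ln] using this
    · have ht : mixingTime P (initLaw μ Z) (1 / 4) = 0 := by exact_mod_cast h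
      have hmix := mixingTime_spec hZ hirr haper (ε := 1 / 4) (by norm_num)
      rw [ht] at hmix
      have hsub (a b : 𝔸 × 𝔸) : a = b := by
        by_contra hab
        have key (a : 𝔸 × 𝔸) : 3 / 4 ≤ initLaw μ Z a := by
          have h1 := hmix a
          have hp := hZ.initLaw_mem_stdSimplex
          have h2 : |(1 : Matrix (𝔸 × 𝔸) (𝔸 × 𝔸) ℝ) a a - initLaw μ Z a| +
              |∑ b ∈ Finset.univ.erase a, (0 - initLaw μ Z b)| ≤
              ∑ b, |(1 : Matrix (𝔸 × 𝔸) (𝔸 × 𝔸) ℝ) a b - initLaw μ Z b| := by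
            rw [← Finset.add_sum_erase _ _ (Finset.mem_univ a)]
            gcongr
            refine (Finset.abs_sum_le_sum_abs _ _).trans_eq (Finset.sum_congr rfl fun b hb => ?_)
            rw [Matrix.one_apply_ne (Finset.ne_of_mem_erase hb).symm]
          have h3 := Finset.add_sum_erase _ (initLaw μ Z) (Finset.mem_univ a)
          rw [hp.2] at h3
          simp only [zero_sub, Finset.sum_neg_distrib, abs_neg, Matrix.one_apply_eq] at h2
          have h4 := le_abs_self (1 - initLaw μ Z a)
          have h5 := le_abs_self (∑ b ∈ Finset.univ.erase a, initLaw μ Z b)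
          rw [tvDist, pow_zero] at h1
          linarith
        have hp := hZ.initLaw_mem_stdSimplex
        have := Finset.add_le_sum (fun x _ => hp.1 x) (Finset.mem_univ a) (Finset.mem_univ b) hab
        rw [hp.2] at this
        linarith [key a, key b]
      refine le_of_eq ?_
      simp only [Ln]
      congr 1
      ext1 i
      exact hsub _ _
  have h (ω' : Ω) : Ln S δ Z n ω' = Ln S δ Z n ω := le_antisymm (hconst _ _) (hconst _ _)
  simp [Wn, h]

theorem hasSubgaussianMGF_Ln (hZ : IsStationaryMarkovChain μ P Z) (hirr : P.IsIrreducible)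
    (haper : IsAperiodic P) (hF : constF μ S P Z ≠ 0) (n : ℕ) {η : ℝ} (hη : η ^ 2 = 1) :
    ProbabilityTheory.HasSubgaussianMGF
      (fun ω => η * (Ln S δ Z n ω - ∫ ω', Ln S δ Z n ω' ∂μ))
      (n * constF μ S P Z / 2).toNNReal μ where
  integrable_exp_mul s := hZ.integrable_word fun w =>
    Real.exp (s * (η * (score S δ w - ∫ ω', Ln S δ Z n ω' ∂μ)))
  mgf_le s := by
    have hne := hZ.nonempty_state
    have hne' : Nonempty 𝔸 := hne.map Prod.fst
    obtain ⟨e⟩ := hne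
    have hF0 := constF_nonneg (μ := μ) (S := S) (P := P) (Z := Z)
    set t := mixingTime P (initLaw μ Z) (1 / 4) with ht
    have ht0 : 0 < t := by
      refine Nat.pos_of_ne_zero fun h => hF ?_
      rw [constF_eq, ← ht, h]; simp
    have key := pathExp_exp_le hZ.stochastic ht0
      (mixingTime_spec hZ hirr haper (by norm_num)) (by linarith [maxChange_nonneg S]) n
      (hammingLip_score (S := S) (δ := δ) e n) hZ.initLaw_mem_stdSimplex (s * η)
    rw [← hZ.integral_eq_pathExp (fun w => score S δ w) e,
      ← hZ.integral_eq_pathExp (fun w => Real.exp (s * η * score S δ w)) e] at key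
    simp only [ProbabilityTheory.mgf, mul_sub, Real.exp_sub, ← mul_assoc]
    rw [integral_div, div_le_iff₀ (Real.exp_pos _), ← Real.exp_add]
    refine key.trans (Real.exp_le_exp.mpr ?_)
    rw [Real.coe_toNNReal _ (by positivity), constF_eq, ← ht, mul_pow s η, hη]
    -- With `c = 2Δ` the exponent is `(9 / 2) Δ² t n s²`, below the allowed `n F s² / 4 = 8 Δ² t n
    -- s²`.
    have : 0 ≤ s ^ 2 * (maxChange S ^ 2 * t * n) := by positivity
    simp only [Ln]
    nlinarith

theorem tail_Wn (hZ : IsStationaryMarkovChain μ P Z) (hirr : P.IsIrreducible)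
    (haper : IsAperiodic P) (hF : constF μ S P Z ≠ 0) (n : ℕ) {s : ℝ} (hs : 0 < s) :
    μ.real {ω | s ≤ Wn μ S δ Z n ω} ≤ 2 * Real.exp (-(s ^ 2 / ((n : ℝ) * constF μ S P Z))) := by
  have hF0 := constF_nonneg (μ := μ) (S := S) (P := P) (Z := Z)
  have h1 := (hasSubgaussianMGF_Ln (δ := δ) hZ hirr haper hF n (η := 1)
    (by norm_num)).measure_ge_le hs.le
  have h2 := (hasSubgaussianMGF_Ln (δ := δ) hZ hirr haper hF n (η := -1)
    (by norm_num)).measure_ge_le hs.le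
  rw [Real.coe_toNNReal _ (by positivity), mul_div_cancel₀ _ two_ne_zero, neg_div] at h1 h2
  have hsub : {ω | s ≤ Wn μ S δ Z n ω} ⊆
      {ω | s ≤ 1 * (Ln S δ Z n ω - ∫ ω', Ln S δ Z n ω' ∂μ)} ∪
      {ω | s ≤ -1 * (Ln S δ Z n ω - ∫ ω', Ln S δ Z n ω' ∂μ)} := by
    intro ω hω
    have hω' : s ≤ |Ln S δ Z n ω - ∫ ω', Ln S δ Z n ω' ∂μ| := hω
    rcases le_abs.mp hω' with h | h
    · exact Or.inl (by simpa using h)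
    · exact Or.inr (by simpa using h)
  linarith [(measureReal_mono hsub).trans (measureReal_union_le (μ := μ) _ _)]

omit [Fintype 𝔸] [DecidableEq 𝔸] [MeasurableSpace 𝔸] [MeasurableSingletonClass 𝔸]
  [IsProbabilityMeasure μ] in
theorem Wn_nonneg (n : ℕ) (ω : Ω) : 0 ≤ Wn μ S δ Z n ω := abs_nonneg _

theorem integral_Wn_rpow_le (hZ : IsStationaryMarkovChain μ P Z) (hirr : P.IsIrreducible)
    (haper : IsAperiodic P) {r : ℝ} (hr : 0 < r) {n : ℕ} (hn : 1 ≤ n) :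
    ∫ ω, Wn μ S δ Z n ω ^ r ∂μ ≤ constC (constF μ S P Z) r * (n : ℝ) ^ (r / 2) := by
  by_cases hF : constF μ S P Z = 0
  · simp [Wn_eq_zero hZ hirr haper hF, hF, constC, Real.zero_rpow hr.ne',
      Real.zero_rpow (half_pos hr).ne']
  have hF0 : 0 < constF μ S P Z := lt_of_le_of_ne constF_nonneg (Ne.symm hF)
  have hn0 : (0 : ℝ) < n := by exact_mod_cast hn
  set κ := (n : ℝ) * constF μ S P Z with hκ
  have hκ0 : 0 < κ := by positivity
  -- The variable `W² / (n F)` has tail `2 * exp (-t)`; the exponent `p = r / 2` turns `2 * p` into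
  -- the factor `r`.
  have key := integral_rpow_le_of_exp_tail (μ := μ) (U := fun ω => Wn μ S δ Z n ω ^ 2 / κ)
    (fun ω => by positivity)
    (hZ.integrable_word fun w => |score S δ w - ∫ ω', Ln S δ Z n ω' ∂μ| ^ 2 / κ).aemeasurable
    (fun t ht => ?_) (half_pos hr)
  · have hW (ω : Ω) : Wn μ S δ Z n ω ^ r = κ ^ (r / 2) * (Wn μ S δ Z n ω ^ 2 / κ) ^ (r / 2) := by
      rw [← Real.mul_rpow hκ0.le (by positivity), mul_div_cancel₀ _ hκ0.ne', ← Real.rpow_natCast,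
        ← Real.rpow_mul (Wn_nonneg n ω)]
      congr 1
      push_cast
      ring
    simp only [hW]
    rw [integral_const_mul, constC]
    refine (mul_le_mul_of_nonneg_left key (by positivity)).trans_eq ?_
    rw [hκ, Real.mul_rpow hn0.le hF0.le]
    ring
  · have h1 := tail_Wn (δ := δ) hZ hirr haper hF n (s := √(t * κ)) (by positivity)
    rw [Real.sq_sqrt (by positivity), ← hκ, mul_div_cancel_right₀ _ hκ0.ne'] at h1
    refine le_trans (le_of_eq ?_) h1
    congr 1
    ext ω
    rw [Set.mem_ofPred_eq, Set.mem_ofPred_eq, le_div_iff₀ hκ0, Real.sqrt_le_left (Wn_nonneg n ω)]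

end Concentration

end PMC

namespace PMC

/-! ### The letter between two given letters -/

section Triplet

variable {E : Type*} [Fintype E] [DecidableEq E] {P : Matrix E E ℝ}

/-- Integration by parts for the letter between `A` and `B`: given its neighbours, it equals `D`
with probability `P A D * P D B / (P ^ 2) A B`, independently of the other letters. -/
theorem pathExp_set_middle (A B D : E) (h : List E → ℝ) (k m : ℕ) (ν : E → ℝ) :
    (P A D * P D B) * pathExp P (k + (m + 3)) ν
        (fun l => if l[k]? = some A ∧ l[k + 2]? = some B then h (l.set (k + 1) D) else 0) =
      (P ^ 2) A B * pathExp P (k + (m + 3)) ν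
        (fun l => if l[k]? = some A ∧ l[k + 2]? = some B ∧ l[k + 1]? = some D then h l else 0) := by
  induction k generalizing ν h with
  | zero =>
    have h0 (m : ℕ) (ν : E → ℝ) (a : Prop) [Decidable a] (g : List E → ℝ) :
        pathExp P m ν (fun l => if a then g l else 0) = if a then pathExp P m ν g else 0 := by
      split_ifs
      · rfl
      · simp [pathExp_eq_sum]
    -- On the left the integrand no longer sees the middle letter, whose sum gives `(P ^ 2) A B`; on
    -- the right the middle letter `D` gives `P A D * P D B`.
    simp only [zero_add, pathExp_succ]
    simp [ite_and, h0, pow_two, Matrix.mul_apply, Finset.mul_sum, Finset.sum_mul]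
    refine Finset.sum_congr rfl fun y _ => ?_
    ring
  | succ k ih =>
    have hk : k + 1 + (m + 3) = (k + (m + 3)) + 1 := by omega
    rw [hk, pathExp_succ, pathExp_succ, Finset.mul_sum, Finset.mul_sum]
    refine Finset.sum_congr rfl fun y _ => ?_
    have := ih (fun l => h (y :: l)) (P y)
    have h2 : k + 1 + 2 = (k + 2) + 1 := by omega
    simp only [h2, List.getElem?_cons_succ, List.set_cons_succ]
    linear_combination ν y * this

theorem pathExp_triplet (hP : P ∈ Matrix.rowStochastic ℝ E) {π : E → ℝ} (hπ : π ∈ stdSimplex ℝ E)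
    (hstat : Matrix.vecMul π P = π) (A B D : E) (k m : ℕ) :
    pathExp P (k + (m + 3)) π
        (fun l => if l[k]? = some A ∧ l[k + 2]? = some B ∧ l[k + 1]? ≠ some D then 1 else 0) =
      π A * ∑ y, P A y * if y = D then 0 else P y B := by
  induction k with
  | zero =>
    have h0 (m : ℕ) {ν : E → ℝ} (hν : ν ∈ stdSimplex ℝ E) (a : Prop) [Decidable a] :
        pathExp P m ν (fun _ => if a then (1 : ℝ) else 0) = if a then 1 else 0 :=
      pathExp_const hP m hν _
    simp only [zero_add, pathExp_succ]
    simp [h0 _ (row_mem_stdSimplex hP _)]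
    simp [ite_and]
  | succ k ih =>
    have hk : k + 1 + (m + 3) = (k + (m + 3)) + 1 := by omega
    have h2 : k + 1 + 2 = (k + 2) + 1 := by omega
    rw [hk, pathExp_succ]
    simp only [h2, List.getElem?_cons_succ]
    rw [sum_mul_pathExp hπ.2, hstat, ih]

end Triplet

/-! ### Expected gain as a sum over framed triplets -/

section Gain

variable {E : Type*} [DecidableEq E] {n : ℕ}

/-- The `i`-th triplet of `z` has the form `(A, ·, B)`. -/
def IsFramed (A B : E) (z : Fin n → E) (i : Fin (n / 3)) : Prop :=
  z (tripletPos i 0) = A ∧ z (tripletPos i 2) = B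

instance (A B : E) (z : Fin n → E) (i : Fin (n / 3)) : Decidable (IsFramed A B z i) :=
  inferInstanceAs (Decidable (_ ∧ _))

theorem tripletPos_injective {i j : Fin (n / 3)} {a b : Fin 3}
    (h : (tripletPos i a : Fin n) = tripletPos j b) : i = j ∧ a = b := by
  have h1 : 3 * i.val + a.val = 3 * j.val + b.val := congrArg Fin.val h
  have ha := a.isLt
  have hb := b.isLt
  exact ⟨Fin.ext (by omega), Fin.ext (by omega)⟩

omit [DecidableEq E] in
theorem update_tripletPos_of_ne (z : Fin n → E) (D : E) {i j : Fin (n / 3)} {a b : Fin 3}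
    (h : ¬(i = j ∧ a = b)) :
    Function.update z (tripletPos i a) D (tripletPos j b) = z (tripletPos j b) :=
  Function.update_of_ne (fun h' => h (by simpa [eq_comm] using tripletPos_injective h')) _ _

/-- Multiplying by the number of eligible triplets cancels the uniform weight of the random choice;
with no eligible triplet both sides vanish. -/
theorem expectedGain_mul_card [Fintype E] (A B D : E) (f : (Fin n → E) → ℝ) (z : Fin n → E) :
    ((eligible A B D z).card : ℝ) * expectedGain A B D f z =
      ∑ i ∈ eligible A B D z, (f (Function.update z (tripletPos i 1) D) - f z) := by
  by_cases h : (eligible A B D z).Nonempty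
  · have hc : ((eligible A B D z).card : ℝ) ≠ 0 := by
      exact_mod_cast h.card_ne_zero
    have key (z' : Fin n → E) : (randomTransform A B D z z').toReal =
        ∑ i ∈ eligible A B D z, if z' = Function.update z (tripletPos i 1) D
          then ((eligible A B D z).card : ℝ)⁻¹ else 0 := by
      rw [randomTransform, dif_pos h, PMF.map_apply, tsum_fintype,
        ENNReal.toReal_sum fun i _ => by
          split_ifs
          · exact PMF.apply_ne_top _ _
          · simp,
        ← Finset.sum_subset (Finset.subset_univ (eligible A B D z)) fun i _ hi => by simp [hi]]
      refine Finset.sum_congr rfl fun i hi => ?_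
      split_ifs <;> simp [hi]
    simp only [expectedGain, key, Finset.sum_mul]
    rw [Finset.sum_comm, Finset.mul_sum]
    refine Finset.sum_congr rfl fun i _ => ?_
    simp only [ite_mul, zero_mul, Finset.sum_ite_eq', Finset.mem_univ, if_true]
    field_simp
  · rw [Finset.not_nonempty_iff_eq_empty] at h
    simp [h]

theorem eligible_nonempty_of_expectedGain_ne_zero [Fintype E] {A B D : E} {f : (Fin n → E) → ℝ}
    {z : Fin n → E} (h : expectedGain A B D f z ≠ 0) : (eligible A B D z).Nonempty := by
  by_contra hne
  refine h (Finset.sum_eq_zero fun z' _ => ?_)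
  rw [randomTransform, dif_neg hne, PMF.pure_apply]
  split_ifs with hz
  · simp [hz]
  · simp

/-- Framed triplets that already have `D` in the middle contribute nothing, so the condition `≠ D`
can be dropped. -/
theorem sum_framed_eq [Fintype E] (A B D : E) (f : (Fin n → E) → ℝ) (z : Fin n → E) :
    ∑ i, (if IsFramed A B z i then f (Function.update z (tripletPos i 1) D) - f z else 0) =
      ((eligible A B D z).card : ℝ) * expectedGain A B D f z := by
  rw [expectedGain_mul_card, eligible, Finset.sum_filter]
  refine Finset.sum_congr rfl fun i _ => ?_
  by_cases hD : z (tripletPos i 1) = D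
  · have : Function.update z (tripletPos i 1) D = z := by rw [← hD, Function.update_eq_self]
    simp [hD, this]
  · by_cases h : IsFramed A B z i
    · rw [if_pos h, if_pos ⟨h.1, h.2, hD⟩]
    · rw [if_neg h, if_neg fun h' => h ⟨h'.1, h'.2.1⟩]

/-- On the exceptional event the Lipschitz bound still gives at least `-c` per eligible triplet;
there are at most `n / 3` of them, so the loss against `ε` is at most `(n / 3) (ε + c)`. -/
theorem expectedGain_lower_bound [Fintype E] (A B D : E) {f : (Fin n → E) → ℝ} {c ε : ℝ}
    (hc : 0 ≤ c) (hε : 0 ≤ ε) (hf : ∀ z i a, |f (Function.update z i a) - f z| ≤ c)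
    (z : Fin n → E) :
    ε * (eligible A B D z).card -
        (n / 3 : ℕ) * ((ε + c) * if ε ≤ expectedGain A B D f z then 0 else 1) ≤
      (eligible A B D z).card * expectedGain A B D f z := by
  have hcard : ((eligible A B D z).card : ℝ) ≤ (n / 3 : ℕ) := by
    exact_mod_cast (Finset.card_le_univ _).trans_eq (Fintype.card_fin _)
  split_ifs with h
  · have : (0 : ℝ) ≤ (eligible A B D z).card := by positivity
    nlinarith
  · have h1 : -(c * (eligible A B D z).card) ≤
        ∑ i ∈ eligible A B D z, (f (Function.update z (tripletPos i 1) D) - f z) := by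
      have := Finset.sum_le_sum fun i (_ : i ∈ eligible A B D z) =>
        (abs_le.mp (hf z (tripletPos i 1) D)).1
      rw [Finset.sum_const, nsmul_eq_mul] at this
      linarith
    rw [expectedGain_mul_card]
    nlinarith

/-- The centred indicator of `D` in the middle of the `i`-th triplet, if this is framed by `A` and
`B`; here `κ` is the inverse of the conditional probability of `D`. -/
noncomputable def middleScore (A B D : E) (κ : ℝ) (z : Fin n → E) (i : Fin (n / 3)) : ℝ :=
  if IsFramed A B z i then (if z (tripletPos i 1) = D then κ else 0) - 1 else 0

theorem middleScore_sq_le (A B D : E) {κ : ℝ} (hκ : 0 ≤ κ) (z : Fin n → E) (i : Fin (n / 3)) :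
    middleScore A B D κ z i * middleScore A B D κ z i ≤ (κ + 1) ^ 2 := by
  unfold middleScore
  split_ifs <;> nlinarith

omit [DecidableEq E] in
theorem isFramed_update (A B D : E) (z : Fin n → E) (i j : Fin (n / 3)) :
    IsFramed A B (Function.update z (tripletPos i 1) D) j ↔ IsFramed A B z j := by
  unfold IsFramed
  rw [update_tripletPos_of_ne z D (by simp), update_tripletPos_of_ne z D (by simp)]

theorem middleScore_update (A B D : E) (κ : ℝ) (z : Fin n → E) {i j : Fin (n / 3)} (h : i ≠ j) :
    middleScore A B D κ (Function.update z (tripletPos i 1) D) j = middleScore A B D κ z j := by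
  unfold middleScore
  simp only [isFramed_update]
  rw [update_tripletPos_of_ne z D (by simp [h])]

end Gain

/-! ### Integration by parts for the triplets of the chain -/

section ChainTriplet

variable {E : Type*} [Fintype E] [DecidableEq E] [MeasurableSpace E] [MeasurableSingletonClass E]
  {Ω : Type*} [MeasurableSpace Ω] {μ : Measure Ω} [IsProbabilityMeasure μ] {P : Matrix E E ℝ}
  {Z : ℕ → Ω → E} {n : ℕ}

omit [Fintype E] [DecidableEq E] [MeasurableSpace E] [MeasurableSingletonClass E] in
theorem ofList_tripletPos_eq_iff (e : E) {l : List E} (hl : l.length = n) (i : Fin (n / 3))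
    (j : Fin 3) (a : E) : ofList e n l (tripletPos i j) = a ↔ l[3 * i.val + j.val]? = some a := by
  have h : 3 * i.val + j.val < l.length := by rw [hl]; exact (tripletPos i j).isLt
  simp [ofList, tripletPos, List.getElem?_eq_getElem h]

namespace IsStationaryMarkovChain

theorem integral_framed_update (hZ : IsStationaryMarkovChain μ P Z) {A B D : E}
    (hD : P A D * P D B ≠ 0) (G : (Fin n → E) → ℝ) (i : Fin (n / 3)) :
    ∫ ω, (fun z => if IsFramed A B z i then G (Function.update z (tripletPos i 1) D) else 0)
        (fun i : Fin n => Z i ω) ∂μ =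
      (P ^ 2) A B / (P A D * P D B) *
        ∫ ω, (fun z => if IsFramed A B z i ∧ z (tripletPos i 1) = D then G z else 0)
          (fun i : Fin n => Z i ω) ∂μ := by
  obtain ⟨e⟩ := hZ.nonempty_state
  obtain ⟨m, hm⟩ : ∃ m, n = 3 * i.val + (m + 3) := ⟨n - 3 * i.val - 3, by omega⟩
  have h1 := hZ.integral_eq_pathExp
    (fun z => if IsFramed A B z i then G (Function.update z (tripletPos i 1) D) else 0) e
  have h2 := hZ.integral_eq_pathExp
    (fun z => if IsFramed A B z i ∧ z (tripletPos i 1) = D then G z else 0) e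
  refine h1.trans (Eq.trans ?_
    (congrArg (fun x => (P ^ 2) A B / (P A D * P D B) * x) h2.symm))
  rw [div_mul_eq_mul_div, eq_div_iff hD, mul_comm _ (P A D * P D B)]
  have key := pathExp_set_middle (P := P) A B D (fun l => G (ofList e n l)) (3 * i.val) m
    (initLaw μ Z)
  rw [← hm] at key
  refine Eq.trans ?_ (key.trans ?_)
  · congr 1
    refine pathExp_congr fun l hl => ?_
    have h1 := ofList_set e l hl (tripletPos i 1) D
    simp only [tripletPos, Fin.val_one] at h1
    rw [h1]
    simp only [IsFramed, ofList_tripletPos_eq_iff e hl]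
    rfl
  · congr 1
    refine pathExp_congr fun l hl => ?_
    simp only [IsFramed, ofList_tripletPos_eq_iff e hl, and_assoc]
    rfl

/-- The factor `κ` undoes the conditional probability of `D`: weighting by `κ 1_D` has the same mean
as overwriting the middle letter by `D`, and the `-1` subtracts the original value. -/
theorem integral_middleScore_mul (hZ : IsStationaryMarkovChain μ P Z) {A B D : E}
    (hD : P A D * P D B ≠ 0) (G : (Fin n → E) → ℝ) (i : Fin (n / 3)) :
    ∫ ω, (fun z => middleScore A B D ((P ^ 2) A B / (P A D * P D B)) z i * G z)
        (fun i : Fin n => Z i ω) ∂μ =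
      ∫ ω, (fun z => if IsFramed A B z i then
        G (Function.update z (tripletPos i 1) D) - G z else 0) (fun i : Fin n => Z i ω) ∂μ := by
  set κ := (P ^ 2) A B / (P A D * P D B) with hκ
  have h1 := hZ.integral_framed_update hD G i
  rw [← hκ, ← integral_const_mul] at h1
  have hl (z : Fin n → E) : middleScore A B D κ z i * G z =
      κ * (if IsFramed A B z i ∧ z (tripletPos i 1) = D then G z else 0) -
        if IsFramed A B z i then G z else 0 := by
    unfold middleScore
    by_cases h : IsFramed A B z i <;> by_cases h' : z (tripletPos i 1) = D <;> simp [h, h']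
    ring
  have hr (z : Fin n → E) :
      (if IsFramed A B z i then G (Function.update z (tripletPos i 1) D) - G z else 0) =
        (if IsFramed A B z i then G (Function.update z (tripletPos i 1) D) else 0) -
          if IsFramed A B z i then G z else 0 := by
    split_ifs <;> simp
  simp only [hl, hr]
  rw [integral_sub (hZ.integrable_word fun z =>
      κ * (if IsFramed A B z i ∧ z (tripletPos i 1) = D then G z else 0))
      (hZ.integrable_word fun z => if IsFramed A B z i then G z else 0),
    integral_sub (hZ.integrable_word fun z =>
      if IsFramed A B z i then G (Function.update z (tripletPos i 1) D) else 0)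
      (hZ.integrable_word fun z => if IsFramed A B z i then G z else 0), ← h1]

/-- Overwriting the middle of triplet `i` does not affect the term of any other triplet `j`, so
integration by parts makes the terms orthogonal and only the diagonal remains. -/
theorem integral_sum_middleScore_sq_le (hZ : IsStationaryMarkovChain μ P Z) {A B D : E}
    (hD : 0 < P A D * P D B) :
    ∫ ω, (∑ i, middleScore A B D ((P ^ 2) A B / (P A D * P D B)) (fun i : Fin n => Z i ω) i) ^ 2 ∂μ
      ≤ (n / 3 : ℕ) * ((P ^ 2) A B / (P A D * P D B) + 1) ^ 2 := by
  have hκ : 0 ≤ (P ^ 2) A B / (P A D * P D B) :=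
    div_nonneg (Matrix.nonneg_of_mem_rowStochastic (pow_mem hZ.stochastic 2)) hD.le
  set κ := (P ^ 2) A B / (P A D * P D B) with hκ'
  have hint (i j : Fin (n / 3)) := hZ.integrable_word fun z : Fin n → E =>
    middleScore A B D κ z i * middleScore A B D κ z j
  have hoff (i j : Fin (n / 3)) (hij : i ≠ j) : ∫ ω,
      middleScore A B D κ (fun i : Fin n => Z i ω) i *
        middleScore A B D κ (fun i : Fin n => Z i ω) j ∂μ = 0 := by
    have := hZ.integral_middleScore_mul hD.ne' (fun z : Fin n → E => middleScore A B D κ z j) i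
    simpa [middleScore_update A B D κ _ hij, ← hκ'] using this
  simp only [pow_two (∑ i, _), Finset.sum_mul_sum]
  rw [integral_finsetSum _ fun i _ => integrable_finsetSum _ fun j _ => hint i j]
  calc ∑ i, ∫ ω, ∑ j, middleScore A B D κ (fun i : Fin n => Z i ω) i *
        middleScore A B D κ (fun i : Fin n => Z i ω) j ∂μ
      ≤ ∑ _i : Fin (n / 3), (κ + 1) ^ 2 := by
        refine Finset.sum_le_sum fun i _ => ?_
        rw [integral_finsetSum _ fun j _ => hint i j,
          Finset.sum_eq_single i (fun j _ hj => hoff i j hj.symm) (by simp)]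
        refine (integral_mono (hint i i) (integrable_const ((κ + 1) ^ 2)) fun ω =>
          middleScore_sq_le A B D hκ _ i).trans_eq (by simp)
    _ = (n / 3 : ℕ) * (κ + 1) ^ 2 := by simp

theorem integral_card_eligible (hZ : IsStationaryMarkovChain μ P Z) (A B D : E) :
    ∫ ω, ((eligible A B D (fun i : Fin n => Z i ω)).card : ℝ) ∂μ =
      (n / 3 : ℕ) * (initLaw μ Z A * ∑ y, P A y * if y = D then 0 else P y B) := by
  obtain ⟨e⟩ := hZ.nonempty_state
  simp only [eligible, Finset.card_filter, Nat.cast_sum, Nat.cast_ite, Nat.cast_one, Nat.cast_zero]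
  rw [integral_finsetSum _ fun i _ => hZ.integrable_word fun z : Fin n → E =>
    if z (tripletPos i 0) = A ∧ z (tripletPos i 2) = B ∧ z (tripletPos i 1) ≠ D then (1 : ℝ) else 0]
  have key (i : Fin (n / 3)) : ∫ ω, (if Z (tripletPos i 0 : Fin n) ω = A ∧
      Z (tripletPos i 2 : Fin n) ω = B ∧ Z (tripletPos i 1 : Fin n) ω ≠ D then (1 : ℝ) else 0) ∂μ =
      initLaw μ Z A * ∑ y, P A y * if y = D then 0 else P y B := by
    obtain ⟨m, hm⟩ : ∃ m, n = 3 * i.val + (m + 3) := ⟨n - 3 * i.val - 3, by omega⟩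
    have h := pathExp_triplet hZ.stochastic hZ.initLaw_mem_stdSimplex hZ.initLaw_vecMul A B D
      (3 * i.val) m
    rw [← hm] at h
    rw [← h, hZ.integral_eq_pathExp (fun z : Fin n → E => if z (tripletPos i 0) = A ∧
      z (tripletPos i 2) = B ∧ z (tripletPos i 1) ≠ D then (1 : ℝ) else 0) e]
    refine pathExp_congr fun l hl => ?_
    simp only [ne_eq, ofList_tripletPos_eq_iff e hl]
    rfl
  simp [key]

end IsStationaryMarkovChain

end ChainTriplet

end PMC

namespace PMC

/-! ### The lower bound for the moments -/

section LowerBound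

variable {𝔸 : Type*} [Fintype 𝔸] [DecidableEq 𝔸] [MeasurableSpace 𝔸]
    [MeasurableSingletonClass 𝔸] {Ω : Type*} [MeasurableSpace Ω] {μ : Measure Ω}
    [IsProbabilityMeasure μ] {S : 𝔸 → 𝔸 → ℝ} {δ : ℝ}
    {P : Matrix (𝔸 × 𝔸) (𝔸 × 𝔸) ℝ} {Z : ℕ → Ω → 𝔸 × 𝔸}

theorem integrable_Wn_rpow (hZ : IsStationaryMarkovChain μ P Z) (n : ℕ) (r : ℝ) :
    Integrable (fun ω => Wn μ S δ Z n ω ^ r) μ :=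
  hZ.integrable_word fun w => |score S δ w - ∫ ω', Ln S δ Z n ω' ∂μ| ^ r

theorem integrable_Wn (hZ : IsStationaryMarkovChain μ P Z) (n : ℕ) :
    Integrable (fun ω => Wn μ S δ Z n ω) μ :=
  hZ.integrable_word fun w => |score S δ w - ∫ ω', Ln S δ Z n ω' ∂μ|

theorem integrable_Wn_pow (hZ : IsStationaryMarkovChain μ P Z) (n k : ℕ) :
    Integrable (fun ω => Wn μ S δ Z n ω ^ k) μ :=
  hZ.integrable_word fun w => |score S δ w - ∫ ω', Ln S δ Z n ω' ∂μ| ^ k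

/-- A lower bound for the covariance of the score with the number of occurrences of `D` between
`A` and `B` gives a lower bound for the variance. -/
theorem integral_Wn_sq_ge (hZ : IsStationaryMarkovChain μ P Z) {A B D : 𝔸 × 𝔸}
    (hD : 0 < P A D * P D B) {ε η ρ s : ℝ} (hε : 0 < ε) (hs : 0 < s) {n : ℕ}
    (hη : 1 - η ≤ μ.real {ω | ε ≤ expectedGain A B D (score S δ) (fun i : Fin n => Z i ω)})
    (hρ : initLaw μ Z A * ∑ y, P A y * (if y = D then 0 else P y B) = ρ) :
    2 * s * ((n / 3 : ℕ) * (ε * ρ - (ε + 2 * maxChange S) * η)) -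
        s ^ 2 * ((n / 3 : ℕ) * ((P ^ 2) A B / (P A D * P D B) + 1) ^ 2) ≤
      ∫ ω, Wn μ S δ Z n ω ^ 2 ∂μ := by
  have hne : Nonempty 𝔸 := hZ.nonempty_state.map Prod.fst
  have hc : 0 ≤ 2 * maxChange S := by linarith [maxChange_nonneg S]
  set κ := (P ^ 2) A B / (P A D * P D B) with hκ
  set a := ∫ ω', Ln S δ Z n ω' ∂μ with ha
  let M : (Fin n → 𝔸 × 𝔸) → ℝ := fun z => ∑ i, middleScore A B D κ z i
  let X : (Fin n → 𝔸 × 𝔸) → ℝ := fun z => score S δ z - a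
  let g : (Fin n → 𝔸 × 𝔸) → ℝ := fun z => expectedGain A B D (score S δ) z
  -- Integration by parts with `G = X`; the centring constant cancels in the difference.
  have hcov : ∫ ω, M (fun i : Fin n => Z i ω) * X (fun i : Fin n => Z i ω) ∂μ =
      ∫ ω, ((eligible A B D (fun i : Fin n => Z i ω)).card : ℝ) * g (fun i : Fin n => Z i ω) ∂μ := by
    simp only [M, g, Finset.sum_mul, ← sum_framed_eq]
    rw [integral_finsetSum _ fun i _ => hZ.integrable_word fun z => middleScore A B D κ z i * X z,
      integral_finsetSum _ fun i _ => hZ.integrable_word fun z => if IsFramed A B z i then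
        score S δ (Function.update z (tripletPos i 1) D) - score S δ z else 0]
    refine Finset.sum_congr rfl fun i _ => ?_
    have := hZ.integral_middleScore_mul hD.ne' X i
    simpa [X] using this
  have hbad : ∫ ω, (if ε ≤ g (fun i : Fin n => Z i ω) then (0 : ℝ) else 1) ∂μ ≤ η := by
    have h1 : ∫ ω, (if ε ≤ g (fun i : Fin n => Z i ω) then (0 : ℝ) else 1) ∂μ =
        1 - μ.real {ω | ε ≤ g (fun i : Fin n => Z i ω)} := by
      have hm : MeasurableSet {ω | ε ≤ g (fun i : Fin n => Z i ω)} :=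
        hZ.measurable_word n (Set.toFinite {w | ε ≤ g w}).measurableSet
      rw [← probReal_compl_eq_one_sub hm, ← integral_indicator_one hm.compl]
      refine integral_congr_ae (ae_of_all _ fun ω => ?_)
      by_cases h : ε ≤ g (fun i : Fin n => Z i ω) <;> simp [h]
    rw [h1]
    linarith
  have hlow : (n / 3 : ℕ) * (ε * ρ - (ε + 2 * maxChange S) * η) ≤
      ∫ ω, M (fun i : Fin n => Z i ω) * X (fun i : Fin n => Z i ω) ∂μ := by
    rw [hcov]
    have h1 := integral_mono (μ := μ)
      (hZ.integrable_word fun z => ε * ((eligible A B D z).card : ℝ) -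
        (n / 3 : ℕ) * ((ε + 2 * maxChange S) * if ε ≤ g z then 0 else 1))
      (hZ.integrable_word fun z => ((eligible A B D z).card : ℝ) * g z)
      fun ω => expectedGain_lower_bound A B D hc hε.le (abs_score_update_sub_le S δ) _
    refine le_trans ?_ h1
    rw [integral_sub (hZ.integrable_word fun z => ε * ((eligible A B D z).card : ℝ))
      (hZ.integrable_word fun z =>
        (n / 3 : ℕ) * ((ε + 2 * maxChange S) * if ε ≤ g z then 0 else 1)),
      integral_const_mul, integral_const_mul, integral_const_mul, hZ.integral_card_eligible, hρ]
    have h2 : (n / 3 : ℕ) * ((ε + 2 * maxChange S) *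
        ∫ ω, (if ε ≤ g (fun i : Fin n => Z i ω) then (0 : ℝ) else 1) ∂μ) ≤
        (n / 3 : ℕ) * ((ε + 2 * maxChange S) * η) := by gcongr
    linarith
  have hsq := hZ.integral_sum_middleScore_sq_le (n := n) hD
  rw [← hκ] at hsq
  -- Cauchy–Schwarz with a free parameter: `2 s M X ≤ s² M² + X²`.
  have hineq : (∫ ω, M (fun i : Fin n => Z i ω) * X (fun i : Fin n => Z i ω) ∂μ) * (2 * s) ≤
      s ^ 2 * ∫ ω, M (fun i : Fin n => Z i ω) ^ 2 ∂μ + ∫ ω, Wn μ S δ Z n ω ^ 2 ∂μ := by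
    rw [← integral_const_mul, ← integral_mul_const, ← integral_add
      (hZ.integrable_word fun z => s ^ 2 * M z ^ 2) (integrable_Wn_pow hZ n 2)]
    refine integral_mono (hZ.integrable_word fun z => M z * X z * (2 * s))
      ((hZ.integrable_word fun z => s ^ 2 * M z ^ 2).add (integrable_Wn_pow hZ n 2)) fun ω => ?_
    have hW : Wn μ S δ Z n ω ^ 2 = X (fun i : Fin n => Z i ω) ^ 2 := sq_abs _
    simp only [hW]
    nlinarith [sq_nonneg (s * M (fun i : Fin n => Z i ω) - X (fun i : Fin n => Z i ω))]
  have h3 := mul_le_mul_of_nonneg_left hsq (sq_nonneg s)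
  have h4 := mul_le_mul_of_nonneg_left hlow (by positivity : 0 ≤ 2 * s)
  linarith

/-- A positive expected gain requires an eligible triplet, so the score hypothesis, used for one `n`
with `η < 1`, already forces such triplets to have positive probability. -/
theorem initLaw_triplet_pos (hZ : IsStationaryMarkovChain μ P Z) {A B D : 𝔸 × 𝔸} {ε η : ℝ}
    (hε : 0 < ε) {n : ℕ} (hη1 : η < 1)
    (hη : 1 - η ≤ μ.real {ω | ε ≤ expectedGain A B D (score S δ) (fun i : Fin n => Z i ω)}) :
    0 < initLaw μ Z A * ∑ y, P A y * (if y = D then 0 else P y B) := by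
  have hm : MeasurableSet {ω | ε ≤ expectedGain A B D (score S δ) (fun i : Fin n => Z i ω)} :=
    hZ.measurable_word n (Set.toFinite {w | ε ≤ expectedGain A B D (score S δ) w}).measurableSet
  have h1 : μ.real {ω | ε ≤ expectedGain A B D (score S δ) (fun i : Fin n => Z i ω)} ≤
      ∫ ω, ((eligible A B D (fun i : Fin n => Z i ω)).card : ℝ) ∂μ := by
    rw [← integral_indicator_one hm]
    refine integral_mono ((integrable_const (1 : ℝ)).indicator hm)
      (hZ.integrable_word fun z => ((eligible A B D z).card : ℝ)) fun ω => ?_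
    by_cases h : ε ≤ expectedGain A B D (score S δ) (fun i : Fin n => Z i ω)
    · have := (eligible_nonempty_of_expectedGain_ne_zero (hε.trans_le h).ne').card_pos
      simpa [Set.indicator_apply, h] using this
    · simp [h]
  rw [hZ.integral_card_eligible] at h1
  exact pos_of_mul_pos_right (by linarith) (Nat.cast_nonneg _)

theorem exists_integral_Wn_sq_ge (hZ : IsStationaryMarkovChain μ P Z) {A B D : 𝔸 × 𝔸}
    (hD : 0 < P A D * P D B) {ε : ℝ} (hε : 0 < ε) (h : IncreasesScore μ S δ Z A B D ε) :
    ∃ c : ℝ, 0 < c ∧ ∀ᶠ n : ℕ in atTop, c * n ≤ ∫ ω, Wn μ S δ Z n ω ^ 2 ∂μ := by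
  obtain ⟨η, hη, hgain⟩ := h
  obtain ⟨n₀, hn₀⟩ := (hη.eventually_lt_const one_pos).exists
  have hρ := initLaw_triplet_pos hZ hε hn₀ (hgain n₀)
  set ρ := initLaw μ Z A * ∑ y, P A y * (if y = D then 0 else P y B) with hρ'
  have hκ : 0 ≤ (P ^ 2) A B / (P A D * P D B) :=
    div_nonneg (Matrix.nonneg_of_mem_rowStochastic (pow_mem hZ.stochastic 2)) hD.le
  set K := ((P ^ 2) A B / (P A D * P D B) + 1) ^ 2 with hK
  have hK0 : 0 < K := by positivity
  have hlim : Tendsto (fun n => (ε + 2 * maxChange S) * η n) atTop (𝓝 0) := by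
    simpa using hη.const_mul (ε + 2 * maxChange S)
  refine ⟨(ε * ρ) ^ 2 / (4 * K) / 5, by positivity, ?_⟩
  filter_upwards [hlim.eventually_lt_const (half_pos (mul_pos hε hρ)), eventually_ge_atTop 3]
    with n hn hn3
  -- For large `n` the covariance is at least `(n / 3) a` with `a = ε ρ / 2`. The choice `s = a / K`
  -- maximises `2 s a - s² K`, with value `(ε ρ)² / (4 K)`.
  have key := integral_Wn_sq_ge hZ hD hε (s := ε * ρ / (2 * K)) (by positivity) (hgain n) hρ'.symm
  refine le_trans ?_ key
  -- The worst case is `n = 5`, where `n / 3 = 1`.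
  have h5 : (n : ℝ) ≤ 5 * (n / 3 : ℕ) := by exact_mod_cast (by omega : n ≤ 5 * (n / 3))
  have h1 : ε * ρ / 2 ≤ ε * ρ - (ε + 2 * maxChange S) * η n := by linarith
  have h2 : 2 * (ε * ρ / (2 * K)) * ((n / 3 : ℕ) * (ε * ρ / 2)) ≤
      2 * (ε * ρ / (2 * K)) * ((n / 3 : ℕ) * (ε * ρ - (ε + 2 * maxChange S) * η n)) := by
    gcongr
  have h3 : 2 * (ε * ρ / (2 * K)) * ((n / 3 : ℕ) * (ε * ρ / 2)) -
      (ε * ρ / (2 * K)) ^ 2 * ((n / 3 : ℕ) * K) = (ε * ρ) ^ 2 / (4 * K) * (n / 3 : ℕ) := by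
    field_simp
    ring
  have h4 := mul_le_mul_of_nonneg_left h5 (by positivity : 0 ≤ (ε * ρ) ^ 2 / (4 * K) / 5)
  linarith

theorem exists_integral_Wn_ge (hZ : IsStationaryMarkovChain μ P Z) (hirr : P.IsIrreducible)
    (haper : IsAperiodic P) {A B D : 𝔸 × 𝔸}
    (hD : 0 < P A D * P D B) {ε : ℝ} (hε : 0 < ε) (h : IncreasesScore μ S δ Z A B D ε) :
    ∃ c : ℝ, 0 < c ∧ ∀ᶠ n : ℕ in atTop, c * √n ≤ ∫ ω, Wn μ S δ Z n ω ∂μ := by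
  obtain ⟨c, hc, hlow⟩ := exists_integral_Wn_sq_ge hZ hD hε h
  set C := |constC (constF μ S P Z) 4| with hC
  have hC0 : 0 ≤ C := abs_nonneg _
  -- Chosen so that, for `T = θ √n`, the part `E W⁴ / T²` is at most half of the lower bound `c n`
  -- for `E W²`; `C + 1` keeps `θ` positive.
  set θ := √(2 * (C + 1) / c) with hθ
  have hθ2 : θ ^ 2 = 2 * (C + 1) / c := Real.sq_sqrt (by positivity)
  have hθ0 : 0 < θ := Real.sqrt_pos.mpr (by positivity)
  refine ⟨c / (2 * θ), by positivity, ?_⟩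
  filter_upwards [hlow, eventually_ge_atTop 1] with n hn hn1
  have hn0 : (0 : ℝ) < n := by exact_mod_cast hn1
  have h4 : ∫ ω, Wn μ S δ Z n ω ^ 4 ∂μ ≤ C * n ^ 2 := by
    have := integral_Wn_rpow_le (S := S) (δ := δ) hZ hirr haper (r := 4) (by norm_num) hn1
    have h42 : (4 : ℝ) / 2 = (2 : ℕ) := by norm_num
    rw [h42, Real.rpow_natCast] at this
    simp only [← Nat.cast_ofNat (R := ℝ) (n := 4), Real.rpow_natCast] at this
    refine this.trans ?_
    gcongr
    exact le_abs_self _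
  set T := θ * √n with hT
  have hT0 : 0 < T := by positivity
  have hT2 : T ^ 2 = 2 * (C + 1) / c * n := by rw [hT, mul_pow, hθ2, Real.sq_sqrt hn0.le]
  -- Truncation at `T`: below it `W² ≤ T W`, above it `W² ≤ W⁴ / T²`.
  have hpt (ω : Ω) : Wn μ S δ Z n ω ^ 2 ≤ T * Wn μ S δ Z n ω + Wn μ S δ Z n ω ^ 4 / T ^ 2 := by
    have hW := Wn_nonneg (μ := μ) (S := S) (δ := δ) (Z := Z) n ω
    set w := Wn μ S δ Z n ω
    rcases le_total w T with hw | hw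
    · have : 0 ≤ w ^ 4 / T ^ 2 := by positivity
      nlinarith
    · have : w ^ 2 ≤ w ^ 4 / T ^ 2 := by
        rw [le_div_iff₀ (by positivity)]
        have : T ^ 2 ≤ w ^ 2 := by gcongr
        nlinarith [sq_nonneg w]
      have : 0 ≤ T * w := by positivity
      linarith
  have hint := integral_mono (integrable_Wn_pow (S := S) (δ := δ) hZ n 2)
    (((integrable_Wn (S := S) (δ := δ) hZ n).const_mul T).add
      ((integrable_Wn_pow (S := S) (δ := δ) hZ n 4).div_const (T ^ 2))) hpt
  simp only [Pi.add_apply] at hint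
  rw [integral_add ((integrable_Wn hZ n).const_mul T)
    ((integrable_Wn_pow hZ n 4).div_const (T ^ 2)), integral_const_mul, integral_div] at hint
  have h5 : (∫ ω, Wn μ S δ Z n ω ^ 4 ∂μ) / T ^ 2 ≤ c * n / 2 := by
    rw [div_le_iff₀ (by positivity), hT2]
    have : c * n / 2 * (2 * (C + 1) / c * n) = (C + 1) * n ^ 2 := by field_simp
    rw [this]
    nlinarith [sq_nonneg (n : ℝ)]
  have h6 : c * n / 2 ≤ T * ∫ ω, Wn μ S δ Z n ω ∂μ := by linarith
  have h7 : c / (2 * θ) * √n * T = c * n / 2 := by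
    rw [hT]
    field_simp
    rw [Real.sq_sqrt hn0.le]
  refine le_of_mul_le_mul_right ?_ hT0
  rw [h7, mul_comm _ T]
  exact h6

theorem isTheta_integral_Wn (hZ : IsStationaryMarkovChain μ P Z) (hirr : P.IsIrreducible)
    (haper : IsAperiodic P) {A B D : 𝔸 × 𝔸}
    (hD : 0 < P A D * P D B) {ε : ℝ} (hε : 0 < ε) (h : IncreasesScore μ S δ Z A B D ε) {r : ℝ}
    (hr : 1 ≤ r) :
    (fun n : ℕ => ∫ ω, Wn μ S δ Z n ω ^ r ∂μ) =Θ[atTop] (fun n : ℕ => (n : ℝ) ^ (r / 2)) := by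
  have hr0 : 0 < r := one_pos.trans_le hr
  have hnn (n : ℕ) : 0 ≤ ∫ ω, Wn μ S δ Z n ω ^ r ∂μ :=
    integral_nonneg fun ω => Real.rpow_nonneg (Wn_nonneg n ω) r
  constructor
  · refine Asymptotics.IsBigO.of_bound (constC (constF μ S P Z) r) ?_
    filter_upwards [eventually_ge_atTop 1] with n hn
    rw [Real.norm_of_nonneg (hnn n), Real.norm_of_nonneg (by positivity)]
    exact integral_Wn_rpow_le hZ hirr haper hr0 hn
  · obtain ⟨c, hc, hlow⟩ := exists_integral_Wn_ge hZ hirr haper hD hε h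
    refine Asymptotics.IsBigO.of_bound (c ^ r)⁻¹ ?_
    filter_upwards [hlow] with n hn
    rw [Real.norm_of_nonneg (hnn n), Real.norm_of_nonneg (by positivity), inv_mul_eq_div,
      le_div_iff₀' (by positivity)]
    -- Jensen's inequality for `x ↦ x ^ r`, where `r ≥ 1` enters.
    have hJ : (∫ ω, Wn μ S δ Z n ω ∂μ) ^ r ≤ ∫ ω, Wn μ S δ Z n ω ^ r ∂μ :=
      (convexOn_rpow hr).map_integral_le (Real.continuous_rpow_const hr0.le).continuousOn isClosed_Ici
        (ae_of_all _ fun ω => Wn_nonneg n ω) (integrable_Wn hZ n) (integrable_Wn_rpow hZ n r)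
    refine le_trans (le_of_eq ?_) ((Real.rpow_le_rpow (by positivity) hn hr0.le).trans hJ)
    rw [Real.mul_rpow hc.le (Real.sqrt_nonneg _), Real.sqrt_eq_rpow,
      ← Real.rpow_mul (Nat.cast_nonneg n)]
    congr 2
    ring

end LowerBound

end PMC

theorem mainTheorem3 {𝔸 : Type*} [Fintype 𝔸] [DecidableEq 𝔸] [MeasurableSpace 𝔸]
    [MeasurableSingletonClass 𝔸] {Ω : Type*} [MeasurableSpace Ω] (μ : Measure Ω)
    [IsProbabilityMeasure μ]
    (S : 𝔸 → 𝔸 → ℝ) (hS : ∀ a b, 0 ≤ S a b) (δ : ℝ)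
    (P : Matrix (𝔸 × 𝔸) (𝔸 × 𝔸) ℝ) (Z : ℕ → Ω → 𝔸 × 𝔸)
    (hZ : PMC.IsStationaryMarkovChain μ P Z)
    (hirr : P.IsIrreducible) (haper : PMC.IsAperiodic P) :
    (∀ n : ℕ, 1 ≤ n → ∀ s : ℝ, 0 < s →
      μ.real {ω | s ≤ PMC.Wn μ S δ Z n ω} ≤
        if PMC.constF μ S P Z = 0 then 0
        else 2 * Real.exp (-(s ^ 2 / ((n : ℝ) * PMC.constF μ S P Z)))) ∧
    (∀ r : ℝ, 0 < r → ∀ n : ℕ, 1 ≤ n →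
      ∫ ω, PMC.Wn μ S δ Z n ω ^ r ∂μ ≤
        PMC.constC (PMC.constF μ S P Z) r * (n : ℝ) ^ (r / 2)) ∧
    (∀ A B D : 𝔸 × 𝔸, 0 < μ.real {ω | Z 0 ω = A ∧ Z 2 ω = B} → 0 < P A D * P D B →
      ∀ ε : ℝ, 0 < ε → PMC.IncreasesScore μ S δ Z A B D ε →
      ∀ r : ℝ, 1 ≤ r →
        (fun n : ℕ => ∫ ω, PMC.Wn μ S δ Z n ω ^ r ∂μ)
          =Θ[atTop] (fun n : ℕ => (n : ℝ) ^ (r / 2))) := by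
  refine ⟨fun n _ s hs => ?_, fun r hr n hn => PMC.integral_Wn_rpow_le hZ hirr haper hr hn,
    fun A B D _ hD ε hε h r hr => PMC.isTheta_integral_Wn hZ hirr haper hD hε h hr⟩
  split_ifs with hF
  · simp [PMC.Wn_eq_zero hZ hirr haper hF, not_le.mpr hs]
  · exact PMC.tail_Wn hZ hirr haper hF n hs
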